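/- Let $p\ge 2$, $q\ge 1$ be integers, $\sigma\in\mathbb C$, $\alpha\in\mathbb R$. Write $k=(u,v)\in\mathbb R^{q}\times\mathbb R^{p}$ and let $g_\alpha\in SO_0(p,q)$ be the hyperbolic rotation by $\alpha$ in the plane of the first coordinate axes of $\mathbb R^q$ and $\mathbb R^p$, i.e. $u_1\mapsto u_1\cosh\alpha+v_1\sinh\alpha$, $v_1\mapsto v_1\cosh\alpha+u_1\sinh\alpha$, the other coordinates being fixed. Let $(T(g)F)(k)=F(g^{-1}k)$ act on the even functions, homogeneous of degree $\sigma$, on the cone $|u|=|v|\neq0$, let $F_0(u,v)=|u|^\sigma$ be the $SO(p)\times SO(q)$-invariant vector, and let $(F_1,F_2)$ be the integral of $F_1\overline{F_2}$ over $S^{q-1}\times S^{p-1}$ with respect to the product of the normalized rotation invariant measures. The zonal spherical function of $SO_0(p,q)$ is $Z_\sigma^{[p,q]}(\alpha)=(T(g_\alpha)F_0,F_0)$. Put $\Lambda(\alpha;x,y)=1+(x^2+y^2)\sinh^2\alpha-2xy\sinh\alpha\cosh\alpha$. Then: 1. (Integral representations.) If $p,q\ge3$, $$Z_\sigma^{[p,q]}(\alpha)=\frac{\Gamma(\frac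 p2)\Gamma(\frac q2)}{\pi\,\Gamma(\frac{p-1}2)\Gamma(\frac{q-1}2)}\int_{-1}^{1}\!\int_{-1}^{1}\Lambda(\alpha;x,y)^{\sigma/2}(1-x^2)^{\frac{p-3}2}(1-y^2)^{\frac{q-3}2}\,dx\,dy;$$ if $p\ge3$, $$Z_\sigma^{[p,2]}(\alpha)=\frac{\Gamma(\frac p2)}{2\pi^{3/2}\,\Gamma(\frac{p-1}2)}\int_0^{2\pi}\!\int_{-1}^{1}\Lambda(\alpha;x,\cos\phi)^{\sigma/2}(1-x^2)^{\frac{p-3}2}\,dx\,d\phi;$$ and $$Z_\sigma^{[2,2]}(\alpha)=\frac1{4\pi^2}\int_0^{2\pi}\!\int_0^{2\pi}\Lambda(\alpha;\cos\chi,\cos\phi)^{\sigma/2}\,d\chi\,d\phi.$$ 2. (Horn series.) With $(a)_n=a(a+1)\cdots(a+n-1)$, for every real $\alpha$ the following two double series converge absolutely and $$Z_\sigma^{[p,q]}(\alpha)=\frac1{\cosh\alpha}\sum_{m,n=0}^\infty\frac{(-\frac\sigma2)_m\,(1-\frac{\sigma+q}2)_m\,(\frac{\sigma+q}2)_n\,(\frac12)_{m+n}}{(\frac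 q2)_{m+n}\,(\frac p2)_m}\,\frac{(\tanh^2\alpha)^{m}(\tanh^2\alpha)^{n}}{m!\,n!},$$ $$Z_\sigma^{[p,q]}(\alpha)=\frac1{\cosh\alpha}\sum_{m,n=0}^\infty\frac{(-\frac\sigma2)_m\,(1-\frac{\sigma+p}2)_m\,(\frac{\sigma+p}2)_n\,(\frac12)_{m+n}}{(\frac p2)_{m+n}\,(\frac q2)_m}\,\frac{(\tanh^2\alpha)^{m}(\tanh^2\alpha)^{n}}{m!\,n!}.$$ 3. (Symmetry.) $Z_\sigma^{[p,q]}(\alpha)=Z_\sigma^{[q,p]}(\alpha)$. 4. (The case $q=1$.) $Z_\sigma^{[p,1]}(\alpha)={}_2F_1\!\left(-\frac\sigma2,\frac{1-\sigma}2;\frac p2;\tanh^2\alpha\right)(\cosh\alpha)^\sigma$. -/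

import Mathlib

open MeasureTheory

noncomputable section

/-- The space `ℝ^{p+q}`, written as pairs `k = (u, v)` with `u ∈ ℝ^q` and `v ∈ ℝ^p`. -/
abbrev PseudoSpace (p q : ℕ) : Type :=
  EuclideanSpace ℝ (Fin q) × EuclideanSpace ℝ (Fin p)

/-- The quadratic form `[k, k] = |u|² - |v|²` of signature `(q, p)`. -/
def pseudoForm {p q : ℕ} (k : PseudoSpace p q) : ℝ := ‖k.1‖ ^ 2 - ‖k.2‖ ^ 2

/-- The hyperbolic rotation `g_α` by `α` in the plane spanned by the first coordinate axis of `ℝ^q`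
and the first coordinate axis of `ℝ^p`; its inverse is the hyperbolic rotation by `-α`. -/
def hyperbolicRotation (p q : ℕ) [NeZero p] [NeZero q] (α : ℝ) :
    PseudoSpace p q ≃ₗ[ℝ] PseudoSpace p q where
  toFun k :=
    (k.1 + EuclideanSpace.single 0 ((Real.cosh α - 1) * k.1 0 + Real.sinh α * k.2 0),
     k.2 + EuclideanSpace.single 0 ((Real.cosh α - 1) * k.2 0 + Real.sinh α * k.1 0))
  invFun k :=
    (k.1 + EuclideanSpace.single 0 ((Real.cosh α - 1) * k.1 0 - Real.sinh α * k.2 0),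
     k.2 + EuclideanSpace.single 0 ((Real.cosh α - 1) * k.2 0 - Real.sinh α * k.1 0))
  map_add' k l := by
    ext i <;> by_cases hi : i = 0 <;> simp [hi] <;> ring
  map_smul' c k := by
    ext i <;> by_cases hi : i = 0 <;> simp [hi] <;> ring
  left_inv k := by
    have h := Real.cosh_sq α
    ext i <;> by_cases hi : i = 0 <;> simp [hi]
    · linear_combination (k.1 0) * h
    · linear_combination (k.2 0) * h
  right_inv k := by
    have h := Real.cosh_sq α
    ext i <;> by_cases hi : i = 0 <;> simp [hi]
    · linear_combination (k.1 0) * h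
    · linear_combination (k.2 0) * h

/-- Hyperbolic rotations preserve the form `[k, k]`. -/
theorem pseudoForm_hyperbolicRotation {p q : ℕ} [NeZero p] [NeZero q] (α : ℝ)
    (k : PseudoSpace p q) : pseudoForm (hyperbolicRotation p q α k) = pseudoForm k := by
  have key : ∀ {n : ℕ} [NeZero n] (u : EuclideanSpace ℝ (Fin n)) (c : ℝ),
      ‖u + EuclideanSpace.single 0 c‖ ^ 2 = ‖u‖ ^ 2 + 2 * (c * u 0) + c ^ 2 := by
    intro n _ u c
    rw [norm_add_sq_real, EuclideanSpace.inner_single_right]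
    simp
  have h := Real.cosh_sq α
  simp only [pseudoForm, hyperbolicRotation, LinearEquiv.coe_mk, LinearMap.coe_mk, AddHom.coe_mk,
    key]
  linear_combination ((k.1 0) ^ 2 - (k.2 0) ^ 2) * h

/-- The action `(T(g) F)(k) = F(g⁻¹ k)` on functions of `k`. -/
def pseudoAction {p q : ℕ} (g : PseudoSpace p q ≃ₗ[ℝ] PseudoSpace p q) (F : PseudoSpace p q → ℂ) :
    PseudoSpace p q → ℂ := fun k => F (g.symm k)

/-- The even function `F(k) = ω^σ`, where `ω = |u| = |v|` on the cone `[k, k] = 0`: homogeneous of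
degree `σ`, invariant under `SO(p) × SO(q)`, and equal to `1` on the section `ω = 1`. -/
def zonalVector (p q : ℕ) (σ : ℂ) : PseudoSpace p q → ℂ := fun k => (‖k.1‖ : ℂ) ^ σ

/-- The scalar product over the section `S^{q-1} × S^{p-1}` (`ω = 1`) of the cone, with respect to
the product of the rotation invariant measures, normalized to total mass one. -/
def sectionInner {p q : ℕ} (F₁ F₂ : PseudoSpace p q → ℂ) : ℂ :=
  ⨍ k : Metric.sphere (0 : EuclideanSpace ℝ (Fin q)) 1 ×
      Metric.sphere (0 : EuclideanSpace ℝ (Fin p)) 1,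
    F₁ (k.1, k.2) * (starRingEnd ℂ) (F₂ (k.1, k.2))
      ∂((volume : Measure (EuclideanSpace ℝ (Fin q))).toSphere.prod
        (volume : Measure (EuclideanSpace ℝ (Fin p))).toSphere)

/-- The zonal spherical function `Z_σ^{[p,q]}(α)`: the matrix element of `T(g_α)` with respect to
the normalized `SO(p) × SO(q)`-invariant vector. -/
def zonalFunction (p q : ℕ) [NeZero p] [NeZero q] (σ : ℂ) (α : ℝ) : ℂ :=
  sectionInner (pseudoAction (hyperbolicRotation p q α) (zonalVector p q σ)) (zonalVector p q σ)

/-- `Λ(α; x, y) = 1 + (x² + y²) sinh² α - 2 x y sinh α cosh α`. -/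
def zonalKernel (α x y : ℝ) : ℝ :=
  1 + (x ^ 2 + y ^ 2) * Real.sinh α ^ 2 - 2 * x * y * Real.sinh α * Real.cosh α

/-- The Pochhammer symbol `(a)_n = a (a + 1) ⋯ (a + n - 1)`. -/
def pochhammerSymbol (a : ℂ) (n : ℕ) : ℂ := (ascPochhammer ℂ n).eval a

/-- The general term of the generalized hypergeometric (Horn) series in `r` variables. A pair
`(u, a)` in `num` (resp. `den`) contributes the factor `(a)_{u_1 n_1 + ⋯ + u_r n_r}` to the
numerator (resp. denominator). -/
def hornTerm {r : ℕ} (num den : List ((Fin r → ℕ) × ℂ)) (x : Fin r → ℂ) (n : Fin r → ℕ) : ℂ :=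
  (num.map fun a => pochhammerSymbol a.2 (∑ j, a.1 j * n j)).prod /
    (den.map fun b => pochhammerSymbol b.2 (∑ j, b.1 j * n j)).prod *
    ∏ i, x i ^ n i / (n i).factorial

/-- The sum of the Horn series. -/
def hornSeries {r : ℕ} (num den : List ((Fin r → ℕ) × ℂ)) (x : Fin r → ℂ) : ℂ :=
  ∑' n : Fin r → ℕ, hornTerm num den x n

/-- Numerator rows of the `₄F₂` series: `10 | -σ/2, 1-(σ+q)/2`, `01 | (σ+q)/2`, `11 | 1/2`. -/
def zonalNum (q : ℕ) (σ : ℂ) : List ((Fin 2 → ℕ) × ℂ) :=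
  [(![1, 0], -σ / 2), (![1, 0], 1 - (σ + q) / 2), (![0, 1], (σ + q) / 2), (![1, 1], 1 / 2)]

/-- Denominator rows of the `₄F₂` series: `11 | q/2`, `10 | p/2`. -/
def zonalDen (p q : ℕ) : List ((Fin 2 → ℕ) × ℂ) :=
  [(![1, 1], (q : ℂ) / 2), (![1, 0], (p : ℂ) / 2)]

/-- The point `(tanh² α, tanh² α)`. -/
def tanhSqPoint (α : ℝ) : Fin 2 → ℂ := fun _ => (Real.tanh α : ℂ) ^ 2

end

/-!
The sphere `S^{p-1}` enters the zonal function only through the law of one coordinate, and the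
result only depends on the moments of that law: they are those of the density proportional to
`(1 - x²) ^ (p / 2 - 3 / 2)`, and any probability measure on `[-1, 1]` with these moments (the
density itself, or the law of `cos φ` when `p = 2`) gives one more integral representation.

For `x, y ∈ [-1, 1]` the kernel is `Λ = cosh² α · (1 - τ ξ₊) (1 - τ ξ₋)` with `τ = tanh α` and
`ξ± = cos (arccos x ± arccos y)`. So `(1 - τ²) ^ (-(s + 1 / 2)) ((1 - τ ξ₊) (1 - τ ξ₋)) ^ s`,
integrated against the two laws, is a power series in `τ` whose coefficients are polynomials in
`s = σ / 2`. The Horn series is another one, hence it suffices to compare the two for `s ∈ ℕ`,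
where the binomial expansion of `((1 - τ²) (1 - y²) + (y - τ x)²) ^ s = (Λ / cosh² α) ^ s` on one
side and the Chu–Vandermonde identity on the other lead to the same finite sum.

When `q = 1` the factor `(1 / 2)_{m+n} / (q / 2)_{m+n}` of the Horn series is `1`, and the double
series is the product of a hypergeometric and a binomial series.
-/

open Finset.HasAntidiagonal (antidiagonal mem_antidiagonal)

section PochhammerSymbol

theorem pochhammerSymbol_zero (a : ℂ) : pochhammerSymbol a 0 = 1 := by simp [pochhammerSymbol]

theorem pochhammerSymbol_succ (a : ℂ) (n : ℕ) :
    pochhammerSymbol a (n + 1) = pochhammerSymbol a n * (a + n) :=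
  ascPochhammer_succ_eval n a

theorem pochhammerSymbol_add (a : ℂ) (m n : ℕ) :
    pochhammerSymbol a (m + n) = pochhammerSymbol a m * pochhammerSymbol (a + m) n := by
  simp only [pochhammerSymbol, ← ascPochhammer_mul, Polynomial.eval_mul, Polynomial.eval_comp,
    Polynomial.eval_add, Polynomial.eval_X, Polynomial.eval_natCast]

theorem pochhammerSymbol_mul_comm (a : ℂ) (m n : ℕ) :
    pochhammerSymbol a m * pochhammerSymbol (a + m) n =
      pochhammerSymbol a n * pochhammerSymbol (a + n) m := by
  rw [← pochhammerSymbol_add, ← pochhammerSymbol_add, add_comm]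

theorem pochhammerSymbol_one (n : ℕ) : pochhammerSymbol 1 n = (n.factorial : ℂ) := by
  simp [pochhammerSymbol]

theorem pochhammerSymbol_ne_zero {a : ℂ} (ha : 0 < a.re) (n : ℕ) : pochhammerSymbol a n ≠ 0 := by
  rw [pochhammerSymbol, Ne, ascPochhammer_eval_eq_zero_iff]
  rintro ⟨k, -, hk⟩
  have h : (k : ℝ) = -a.re := by simpa using congrArg Complex.re hk
  linarith [(k.cast_nonneg : (0 : ℝ) ≤ k)]

theorem pochhammerSymbol_half_ne_zero (n : ℕ) : pochhammerSymbol (1 / 2) n ≠ 0 :=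
  pochhammerSymbol_ne_zero (by norm_num) n

theorem norm_pochhammerSymbol_le {x : ℝ} {b : ℂ} (hx : 0 ≤ x) (hb : x ≤ b.re) (n : ℕ) :
    ‖pochhammerSymbol x n‖ ≤ ‖pochhammerSymbol b n‖ := by
  induction n with
  | zero => simp [pochhammerSymbol_zero]
  | succ n ih =>
    have h : ‖(x + n : ℂ)‖ ≤ ‖b + n‖ := calc
      ‖(x + n : ℂ)‖ = x + n := by
        exact_mod_cast Complex.norm_of_nonneg (add_nonneg hx n.cast_nonneg)
      _ ≤ (b + n).re := by simpa using hb
      _ ≤ ‖b + n‖ := Complex.re_le_norm _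
    rw [pochhammerSymbol_succ, pochhammerSymbol_succ, norm_mul, norm_mul]
    gcongr

theorem pochhammerSymbol_neg_natCast_eq_zero {s m : ℕ} (h : s < m) :
    pochhammerSymbol (-(s : ℂ)) m = 0 :=
  ascPochhammer_eval_neg_coe_nat_of_lt h

theorem pochhammerSymbol_one_sub_add_mul (c : ℂ) (m r : ℕ) :
    pochhammerSymbol (1 - ((m + r : ℕ) + c)) m * pochhammerSymbol c r =
      (-1) ^ m * pochhammerSymbol c (m + r) := by
  rw [show (1 - ((m + r : ℕ) + c) : ℂ) = -(c + r + m - 1) by push_cast; ring, pochhammerSymbol,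
    ascPochhammer_eval_neg_eq_descPochhammer, descPochhammer_eval_eq_ascPochhammer,
    show c + r + m - 1 - m + 1 = c + r by ring, add_comm m r, pochhammerSymbol_add]
  simp only [pochhammerSymbol]
  ring

theorem pochhammerSymbol_neg_natCast_mul (m r : ℕ) :
    pochhammerSymbol (-((m + r : ℕ) : ℂ)) m * (r.factorial : ℂ) =
      (-1) ^ m * ((m + r).factorial : ℂ) := by
  have h := pochhammerSymbol_one_sub_add_mul 1 m r
  rwa [pochhammerSymbol_one, pochhammerSymbol_one,
    show (1 - ((m + r : ℕ) + 1) : ℂ) = -((m + r : ℕ) : ℂ) by ring] at h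

theorem pochhammerSymbol_div_factorial (a : ℂ) (n : ℕ) :
    pochhammerSymbol a n / (n.factorial : ℂ) = Ring.multichoose a n := by
  have h := Ring.factorial_nsmul_multichoose_eq_ascPochhammer a n
  rw [Polynomial.ascPochhammer_smeval_cast, Polynomial.ascPochhammer_smeval_eq_eval] at h
  rw [pochhammerSymbol, ← h, nsmul_eq_mul,
    mul_div_cancel_left₀ _ (Nat.cast_ne_zero.2 n.factorial_ne_zero)]

theorem pochhammerSymbol_add_left (a b : ℂ) (n : ℕ) :
    pochhammerSymbol (a + b) n / (n.factorial : ℂ) =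
      ∑ ij ∈ antidiagonal n, pochhammerSymbol a ij.1 / (ij.1.factorial : ℂ) *
        (pochhammerSymbol b ij.2 / (ij.2.factorial : ℂ)) := by
  simp only [pochhammerSymbol_div_factorial]
  have h := Ring.add_choose_eq (r := -a) (s := -b) n (Commute.all _ _)
  rw [← neg_add, Ring.choose_neg'] at h
  refine smul_right_injective _ (Int.negOnePow n).isUnit.ne_zero (h.trans ?_)
  simp only [Finset.smul_sum]
  refine Finset.sum_congr rfl fun ij hij => ?_
  rw [Ring.choose_neg', Ring.choose_neg', ← mem_antidiagonal.1 hij, Nat.cast_add,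
    Int.negOnePow_add, smul_mul_smul_comm]
  rfl

theorem factorial_two_mul (n : ℕ) :
    ((2 * n).factorial : ℂ) = 4 ^ n * n.factorial * pochhammerSymbol (1 / 2) n := by
  induction n with
  | zero => simp [pochhammerSymbol_zero]
  | succ n ih =>
    rw [pochhammerSymbol_succ, show 2 * (n + 1) = 2 * n + 1 + 1 by ring, Nat.factorial_succ,
      Nat.factorial_succ, Nat.factorial_succ]
    push_cast
    rw [ih]
    ring

theorem hasSum_pochhammerSymbol (a : ℂ) {z : ℂ} (hz : ‖z‖ < 1) :
    HasSum (fun n : ℕ => pochhammerSymbol a n / (n.factorial : ℂ) * z ^ n) ((1 - z) ^ (-a)) := by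
  have h := (Complex.one_div_one_sub_cpow_hasFPowerSeriesOnBall_zero a).hasSum (y := z)
    (by simpa [enorm_eq_nnnorm, ← NNReal.coe_lt_coe] using hz)
  simp only [pochhammerSymbol_div_factorial, Ring.multichoose_eq]
  simpa [Complex.cpow_neg, mul_comm] using h

theorem hasSum_pochhammerSymbol_mul (c d : ℂ) (r : ℕ) {t : ℂ} (ht : ‖t‖ < 1) :
    HasSum (fun n : ℕ => pochhammerSymbol c n / (n.factorial : ℂ) *
        (pochhammerSymbol (d + (c + n)) r / (r.factorial : ℂ)) * t ^ n)
      (∑ ij ∈ antidiagonal r, pochhammerSymbol d ij.1 / (ij.1.factorial : ℂ) *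
        (pochhammerSymbol c ij.2 / (ij.2.factorial : ℂ)) * (1 - t) ^ (-(c + ij.2))) := by
  refine (hasSum_sum fun ij (_ : ij ∈ antidiagonal r) =>
    (hasSum_pochhammerSymbol (c + ij.2) ht).mul_left (pochhammerSymbol d ij.1 /
      (ij.1.factorial : ℂ) * (pochhammerSymbol c ij.2 / (ij.2.factorial : ℂ)))).congr_fun
    fun n => ?_
  rw [pochhammerSymbol_add_left, Finset.mul_sum, Finset.sum_mul]
  refine Finset.sum_congr rfl fun ij _ => ?_
  linear_combination (pochhammerSymbol d ij.1 / (ij.1.factorial : ℂ) / (ij.2.factorial : ℂ) /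
    (n.factorial : ℂ) * t ^ n) * pochhammerSymbol_mul_comm c n ij.2

theorem summable_norm_hypergeometric (a b c : ℂ) {t : ℂ} (ht : ‖t‖ < 1) :
    Summable fun n : ℕ => ‖pochhammerSymbol a n * pochhammerSymbol b n /
      (pochhammerSymbol c n * n.factorial) * t ^ n‖ := by
  obtain ⟨r, htr, hr1⟩ := exists_between ht
  have tendsto_ratio (x y : ℂ) :
      Filter.Tendsto (fun n : ℕ => (x + n) / (y + n)) Filter.atTop (nhds 1) := by
    simpa using tendsto_add_mul_div_add_mul_atTop_nhds x y (1 : ℂ) one_ne_zero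
  have h : Filter.Tendsto (fun n : ℕ => ‖(a + n) / (c + n) * ((b + n) / (1 + n)) * t‖)
      Filter.atTop (nhds ‖t‖) := by
    simpa using (((tendsto_ratio a c).mul (tendsto_ratio b 1)).mul_const t).norm
  refine summable_of_ratio_norm_eventually_le hr1 ?_
  filter_upwards [h.eventually (gt_mem_nhds htr)] with n hn
  rw [norm_norm, norm_norm]
  refine le_trans (le_of_eq ?_) (mul_le_mul_of_nonneg_right hn.le (norm_nonneg _))
  rw [← norm_mul]
  congr 1
  simp only [pochhammerSymbol_succ, Nat.factorial_succ, Nat.cast_mul, Nat.cast_add, Nat.cast_one,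
    pow_succ, div_eq_mul_inv, mul_inv]
  ring

end PochhammerSymbol

section ZonalSeries

/-- The term of index `k = (m, n)` of the double series of the zonal function, with `a` for `p / 2`,
`b` for `q / 2`, `s` for `σ / 2`, and `t` for `tanh² α`. -/
noncomputable def zonalTerm (a b s t : ℂ) (k : ℕ × ℕ) : ℂ :=
  pochhammerSymbol (-s) k.1 * pochhammerSymbol (1 - (s + b)) k.1 * pochhammerSymbol (s + b) k.2 *
    pochhammerSymbol (1 / 2) (k.1 + k.2) /
    (pochhammerSymbol b (k.1 + k.2) * pochhammerSymbol a k.1) *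
    (t ^ (k.1 + k.2) / (k.1.factorial * k.2.factorial))

theorem hornTerm_zonal (p q : ℕ) (σ : ℂ) (α : ℝ) (n : Fin 2 → ℕ) :
    hornTerm (zonalNum q σ) (zonalDen p q) (tanhSqPoint α) n =
      zonalTerm (p / 2) (q / 2) (σ / 2) ((Real.tanh α : ℂ) ^ 2) (n 0, n 1) := by
  simp only [hornTerm, zonalNum, zonalDen, tanhSqPoint, zonalTerm, List.map, List.prod_cons,
    List.prod_nil, Fin.sum_univ_two, Fin.prod_univ_two, Matrix.cons_val_zero, Matrix.cons_val_one,
    one_mul, zero_mul, add_zero, zero_add, mul_one, add_div, neg_div]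
  rw [div_mul_div_comm, pow_add]
  ring

theorem summable_norm_zonalTerm (a : ℂ) {b : ℂ} (hb : 1 / 2 ≤ b.re) (s : ℂ) {t : ℂ}
    (ht : ‖t‖ < 1) : Summable fun k => ‖zonalTerm a b s t k‖ := by
  have ratio_le_one (n : ℕ) : ‖pochhammerSymbol (1 / 2) n / pochhammerSymbol b n‖ ≤ 1 := by
    have h := norm_pochhammerSymbol_le (x := 1 / 2) (by norm_num) hb n
    push_cast at h
    exact norm_div (pochhammerSymbol (1 / 2) n) _ ▸ div_le_one_of_le₀ h (norm_nonneg _)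
  have h := (summable_norm_hypergeometric (-s) (1 - (s + b)) a ht).mul_norm
    (hasSum_pochhammerSymbol (s + b) ht).summable.norm
  refine h.of_nonneg_of_le (fun _ => norm_nonneg _) fun k => ?_
  refine le_trans (le_of_eq ?_) (mul_le_of_le_one_right (norm_nonneg _) (ratio_le_one (k.1 + k.2)))
  rw [← norm_mul]
  congr 1
  simp only [zonalTerm, pow_add, div_eq_mul_inv, mul_inv]
  ring

theorem pochhammerSymbol_natCast_ratio {b : ℂ} (hb : 0 < b.re) (m r n : ℕ) :
    pochhammerSymbol (-(m + r : ℕ)) m * pochhammerSymbol (1 - ((m + r : ℕ) + b)) m *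
        pochhammerSymbol ((m + r : ℕ) + b) n / pochhammerSymbol b (m + n) =
      (m + r).factorial / pochhammerSymbol b r *
        (pochhammerSymbol (b + (m + n : ℕ)) r / r.factorial) := by
  have h1 := pochhammerSymbol_neg_natCast_mul m r
  have h2 := pochhammerSymbol_one_sub_add_mul b m r
  have h3 := pochhammerSymbol_add b (m + n) r
  rw [show m + n + r = m + r + n by ring, pochhammerSymbol_add, add_comm b (m + r : ℕ)] at h3
  have sign_sq : ((-1 : ℂ) ^ m) * (-1) ^ m = 1 := by rw [← mul_pow]; simp
  rw [div_mul_div_comm, div_eq_div_iff (pochhammerSymbol_ne_zero hb _)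
    (mul_ne_zero (pochhammerSymbol_ne_zero hb _) (Nat.cast_ne_zero.2 r.factorial_ne_zero))]
  linear_combination
    pochhammerSymbol (1 - ((m + r : ℕ) + b)) m * pochhammerSymbol b r *
      pochhammerSymbol ((m + r : ℕ) + b) n * h1 +
    (m + r).factorial * pochhammerSymbol ((m + r : ℕ) + b) n *
      ((-1) ^ m * h2 + pochhammerSymbol b (m + r) * sign_sq) +
    (m + r).factorial * h3

theorem zonalTerm_natCast (a : ℂ) {b : ℂ} (hb : 0 < b.re) (m r n : ℕ) (t : ℂ) :
    zonalTerm a b (m + r : ℕ) t (m, n) = (m + r).factorial * pochhammerSymbol (1 / 2) m /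
      (m.factorial * pochhammerSymbol b r * pochhammerSymbol a m) * t ^ m *
      (pochhammerSymbol (1 / 2 + m) n / n.factorial *
        (pochhammerSymbol (b + (m + n : ℕ)) r / r.factorial) * t ^ n) := calc
  _ = pochhammerSymbol (-(m + r : ℕ)) m * pochhammerSymbol (1 - ((m + r : ℕ) + b)) m *
        pochhammerSymbol ((m + r : ℕ) + b) n / pochhammerSymbol b (m + n) *
      (pochhammerSymbol (1 / 2) (m + n) * t ^ (m + n) /
        (pochhammerSymbol a m * (m.factorial * n.factorial))) := by
    rw [zonalTerm]
    ring
  _ = _ := by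
    rw [pochhammerSymbol_natCast_ratio hb, pochhammerSymbol_add (1 / 2) m n, pow_add]
    ring

/-- The term of index `(i, j, m)`, where `i + j + m = s`, of the finite triple sum which the double
series becomes, up to the factor `s! (1 - t) ^ (-(s + 1 / 2))`, when `s` is a natural number. -/
noncomputable def zonalPolynomialTerm (a b t : ℂ) (i j m : ℕ) : ℂ :=
  pochhammerSymbol (b - 1 / 2) i * pochhammerSymbol (1 / 2) (m + j) /
    (pochhammerSymbol a m * pochhammerSymbol b (i + j)) *
    ((1 - t) ^ i * t ^ m / (i.factorial * j.factorial * m.factorial))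

theorem hasSum_zonalTerm_natCast (a : ℂ) {b : ℂ} (hb : 0 < b.re) (m r : ℕ) {t : ℂ}
    (ht : ‖t‖ < 1) :
    HasSum (fun n => zonalTerm a b (m + r : ℕ) t (m, n))
      ((m + r).factorial * (1 - t) ^ (-((m + r : ℕ) + 1 / 2 : ℂ)) *
        ∑ ij ∈ antidiagonal r, zonalPolynomialTerm a b t ij.1 ij.2 m) := by
  have one_sub_ne_zero : 1 - t ≠ 0 := sub_ne_zero.2 fun h => by simp [← h] at ht
  have split_base (n : ℕ) : b + (m + n : ℕ) = b - 1 / 2 + (1 / 2 + m + n) := by push_cast; ring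
  simp only [zonalTerm_natCast a hb, split_base]
  refine (congrArg (HasSum _ · _) ?_).mp
    ((hasSum_pochhammerSymbol_mul (1 / 2 + m) (b - 1 / 2) r ht).mul_left _)
  rw [Finset.mul_sum, Finset.mul_sum]
  refine Finset.sum_congr rfl fun ij hij => ?_
  have exponent : -(1 / 2 + m + ij.2 : ℂ) = -((m + r : ℕ) + 1 / 2) + ij.1 := by
    rw [← mem_antidiagonal.1 hij]
    push_cast
    ring
  rw [exponent, Complex.cpow_add _ _ one_sub_ne_zero, Complex.cpow_natCast, zonalPolynomialTerm,
    pochhammerSymbol_add (1 / 2) m, ← mem_antidiagonal.1 hij]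
  ring

theorem tsum_zonalTerm_natCast (a : ℂ) {b : ℂ} (hb : 1 / 2 ≤ b.re) (s : ℕ) {t : ℂ}
    (ht : ‖t‖ < 1) :
    ∑' k, zonalTerm a b s t k = s.factorial * (1 - t) ^ (-(s + 1 / 2 : ℂ)) *
      ∑ mr ∈ antidiagonal s, ∑ ij ∈ antidiagonal mr.2,
        zonalPolynomialTerm a b t ij.1 ij.2 mr.1 := by
  have hb' : 0 < b.re := by linarith
  have vanish (m : ℕ) (hm : m ∉ Finset.range (s + 1)) : ∑' n, zonalTerm a b s t (m, n) = 0 := by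
    have h : s < m := by simpa using hm
    simp [zonalTerm, pochhammerSymbol_neg_natCast_eq_zero h]
  rw [(summable_norm_zonalTerm a hb s ht).of_norm.tsum_prod, tsum_eq_sum vanish,
    ← Finset.Nat.sum_antidiagonal_eq_sum_range_succ_mk fun mr => ∑' n, zonalTerm a b s t (mr.1, n),
    Finset.mul_sum]
  refine Finset.sum_congr rfl fun mr hmr => ?_
  rw [← mem_antidiagonal.1 hmr]
  exact (hasSum_zonalTerm_natCast a hb' mr.1 mr.2 ht).tsum_eq

end ZonalSeries

section PolynomialSeries

theorem hasSum_mul_prod {f g : ℕ → ℂ} {a b : ℂ} (hf : HasSum f a) (hg : HasSum g b) :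
    HasSum (fun k : ℕ × ℕ => f k.1 * g k.2) (a * b) :=
  hf.mul hg (summable_mul_of_summable_norm hf.summable.norm hg.summable.norm)

/-- A family of functions of `τ` in the unit disc, given by power series the coefficients of which
are polynomials in the parameter `s`. Such a family is determined by its members with `s ∈ ℕ`. -/
def HasPolynomialSeries (f : ℂ → ℂ → ℂ) : Prop :=
  ∃ a : ℕ → Polynomial ℂ, ∀ s τ : ℂ, ‖τ‖ < 1 →
    HasSum (fun n => (a n).eval s * τ ^ n) (f s τ)

theorem HasPolynomialSeries.of_hasSum {ι : Type*} {f : ℂ → ℂ → ℂ} (d : ι → ℕ)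
    (hd : ∀ n, (d ⁻¹' {n}).Finite) (c : ι → Polynomial ℂ)
    (h : ∀ s τ : ℂ, ‖τ‖ < 1 → HasSum (fun i => (c i).eval s * τ ^ d i) (f s τ)) :
    HasPolynomialSeries f := by
  refine ⟨fun n => ∑ i ∈ (hd n).toFinset, c i, fun s τ hτ => ?_⟩
  refine ((Equiv.sigmaFiberEquiv d).hasSum_iff.2 (h s τ hτ)).sigma fun n => ?_
  have : Fintype {i // d i = n} := (hd n).fintype
  have fiber_sum := hasSum_fintype fun i : {i // d i = n} => (c i).eval s * τ ^ d i
  rw [← Finset.sum_subtype (hd n).toFinset (by simp) fun i => (c i).eval s * τ ^ d i] at fiber_sum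
  rw [Polynomial.eval_finsetSum, Finset.sum_mul, Finset.sum_congr rfl fun i hi => ?_]
  · exact fiber_sum
  · rw [show d i = n by simpa using hi]

theorem finite_preimage_add (n : ℕ) : ((fun k : ℕ × ℕ => k.1 + k.2) ⁻¹' {n}).Finite :=
  (antidiagonal n).finite_toSet.subset fun k hk => by simpa using hk

theorem HasPolynomialSeries.mul {f g : ℂ → ℂ → ℂ} (hf : HasPolynomialSeries f)
    (hg : HasPolynomialSeries g) : HasPolynomialSeries fun s τ => f s τ * g s τ := by
  obtain ⟨a, ha⟩ := hf
  obtain ⟨b, hb⟩ := hg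
  refine .of_hasSum (fun k : ℕ × ℕ => k.1 + k.2) finite_preimage_add (fun k => a k.1 * b k.2)
    fun s τ hτ => ?_
  refine (hasSum_mul_prod (ha s τ hτ) (hb s τ hτ)).congr_fun fun k => ?_
  rw [Polynomial.eval_mul, pow_add]
  ring

theorem HasPolynomialSeries.comp_pow {f : ℂ → ℂ → ℂ} (hf : HasPolynomialSeries f) {d : ℕ}
    (hd : d ≠ 0) : HasPolynomialSeries fun s τ => f s (τ ^ d) := by
  obtain ⟨a, ha⟩ := hf
  refine .of_hasSum (fun n => d * n)
    (fun n => (Set.finite_singleton n).preimage (mul_right_injective₀ hd).injOn) a fun s τ hτ => ?_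
  simpa only [pow_mul] using ha s (τ ^ d) (norm_pow τ d ▸ pow_lt_one₀ (norm_nonneg _) hτ hd)

theorem eq_of_hasSum_pow_eq {a b : ℕ → ℂ} {f : ℂ → ℂ}
    (ha : ∀ τ : ℂ, ‖τ‖ < 1 → HasSum (fun n => a n * τ ^ n) (f τ))
    (hb : ∀ τ : ℂ, ‖τ‖ < 1 → HasSum (fun n => b n * τ ^ n) (f τ)) : a = b := by
  have hasFPowerSeriesAt {a : ℕ → ℂ}
      (ha : ∀ τ : ℂ, ‖τ‖ < 1 → HasSum (fun n => a n * τ ^ n) (f τ)) :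
      HasFPowerSeriesAt f (FormalMultilinearSeries.ofScalars ℂ a) 0 := by
    refine HasFPowerSeriesOnBall.hasFPowerSeriesAt (r := 1) ⟨?_, one_pos, fun {y} hy => ?_⟩
    · refine ENNReal.le_of_forall_nnreal_lt fun r hr => ?_
      refine FormalMultilinearSeries.le_radius_of_summable_norm _ ?_
      have hr' : ‖((r : ℝ) : ℂ)‖ < 1 := by simpa using hr
      simpa [FormalMultilinearSeries.ofScalars_norm] using (ha _ hr').summable.norm
    · simpa [mul_comm] using ha y (by simpa [enorm_eq_nnnorm, ← NNReal.coe_lt_coe] using hy)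
  exact FormalMultilinearSeries.ofScalars_series_injective ℂ ℂ
    ((hasFPowerSeriesAt ha).eq_formalMultilinearSeries (hasFPowerSeriesAt hb))

theorem HasPolynomialSeries.eq_of_natCast {f g : ℂ → ℂ → ℂ} (hf : HasPolynomialSeries f)
    (hg : HasPolynomialSeries g) (h : ∀ (s : ℕ) (τ : ℂ), ‖τ‖ < 1 → f s τ = g s τ) (s : ℂ) {τ : ℂ}
    (hτ : ‖τ‖ < 1) : f s τ = g s τ := by
  obtain ⟨a, ha⟩ := hf
  obtain ⟨b, hb⟩ := hg
  have hab : a = b := by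
    funext n
    refine Polynomial.eq_of_infinite_eval_eq _ _
      ((Set.infinite_range_of_injective (Nat.cast_injective (R := ℂ))).mono ?_)
    rintro _ ⟨k, rfl⟩
    exact congrFun (eq_of_hasSum_pow_eq (ha k) fun τ hτ => h k τ hτ ▸ hb k τ hτ) n
  exact (ha s τ hτ).unique (hab ▸ hb s τ hτ)

theorem eval_ascPochhammer_comp (P : Polynomial ℂ) (s : ℂ) (n : ℕ) :
    ((ascPochhammer ℂ n).comp P).eval s = pochhammerSymbol (P.eval s) n :=
  Polynomial.eval_comp

theorem hasPolynomialSeries_one_sub_cpow (P : Polynomial ℂ) :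
    HasPolynomialSeries fun s τ => (1 - τ) ^ (-P.eval s) := by
  refine ⟨fun n => Polynomial.C (n.factorial : ℂ)⁻¹ * (ascPochhammer ℂ n).comp P, fun s τ hτ => ?_⟩
  refine (hasSum_pochhammerSymbol (P.eval s) hτ).congr_fun fun n => ?_
  rw [Polynomial.eval_mul, Polynomial.eval_C, eval_ascPochhammer_comp]
  ring

theorem hasPolynomialSeries_tsum_zonalTerm (a : ℂ) {b : ℂ} (hb : 1 / 2 ≤ b.re) :
    HasPolynomialSeries fun s t => ∑' k, zonalTerm a b s t k := by
  refine .of_hasSum (fun k : ℕ × ℕ => k.1 + k.2) finite_preimage_add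
    (fun k => Polynomial.C (pochhammerSymbol (1 / 2) (k.1 + k.2) /
      (pochhammerSymbol b (k.1 + k.2) * pochhammerSymbol a k.1) /
        (k.1.factorial * k.2.factorial)) *
      ((ascPochhammer ℂ k.1).comp (-Polynomial.X) *
        (ascPochhammer ℂ k.1).comp (1 - (Polynomial.X + Polynomial.C b)) *
        (ascPochhammer ℂ k.2).comp (Polynomial.X + Polynomial.C b))) fun s t ht => ?_
  refine (summable_norm_zonalTerm a hb s ht).of_norm.hasSum.congr_fun fun k => ?_
  simp only [Polynomial.eval_mul, Polynomial.eval_C, eval_ascPochhammer_comp, Polynomial.eval_add,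
    Polynomial.eval_sub, Polynomial.eval_one, Polynomial.eval_neg, Polynomial.eval_X, zonalTerm]
  ring

variable {Ω : Type*} [MeasurableSpace Ω] {μ : Measure Ω} [IsFiniteMeasure μ] {f g : Ω → ℂ}

theorem hasSum_integral_one_sub_mul_cpow (hf : AEStronglyMeasurable f μ)
    (hg : AEStronglyMeasurable g μ) (hf1 : ∀ w, ‖f w‖ ≤ 1) (hg1 : ∀ w, ‖g w‖ ≤ 1) (s : ℂ) {τ : ℂ}
    (hτ : ‖τ‖ < 1) :
    HasSum (fun k : ℕ × ℕ => pochhammerSymbol (-s) k.1 / k.1.factorial * τ ^ k.1 *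
        (pochhammerSymbol (-s) k.2 / k.2.factorial * τ ^ k.2) * ∫ w, f w ^ k.1 * g w ^ k.2 ∂μ)
      (∫ w, (1 - τ * f w) ^ s * (1 - τ * g w) ^ s ∂μ) := by
  set c : ℕ → ℂ := fun n => pochhammerSymbol (-s) n / n.factorial * τ ^ n
  have summable_c : Summable fun k : ℕ × ℕ => ‖c k.1 * c k.2‖ :=
    (hasSum_pochhammerSymbol (-s) hτ).summable.norm.mul_norm
      (hasSum_pochhammerSymbol (-s) hτ).summable.norm
  have binomial_series {z : ℂ} (hz : ‖z‖ ≤ 1) :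
      HasSum (fun n => c n * z ^ n) ((1 - τ * z) ^ s) := by
    have h : ‖τ * z‖ < 1 :=
      norm_mul τ z ▸ (mul_le_of_le_one_right (norm_nonneg _) hz).trans_lt hτ
    simpa only [neg_neg, mul_pow, mul_assoc, c] using hasSum_pochhammerSymbol (-s) h
  simp only [← integral_const_mul]
  refine hasSum_integral_of_dominated_convergence (fun k _ => ‖c k.1 * c k.2‖)
    (fun k => ((hf.pow _).mul (hg.pow _)).const_mul _) (fun k => .of_forall fun w => ?_)
    (.of_forall fun _ => summable_c) (integrable_const _) (.of_forall fun w => ?_)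
  · rw [norm_mul, norm_mul (f w ^ k.1), norm_pow, norm_pow]
    exact mul_le_of_le_one_right (norm_nonneg _) (mul_le_one₀
      (pow_le_one₀ (norm_nonneg _) (hf1 w)) (by positivity) (pow_le_one₀ (norm_nonneg _) (hg1 w)))
  · refine (hasSum_mul_prod (binomial_series (hf1 w)) (binomial_series (hg1 w))).congr_fun
      fun k => ?_
    ring

theorem hasPolynomialSeries_integral_one_sub_mul_cpow (hf : AEStronglyMeasurable f μ)
    (hg : AEStronglyMeasurable g μ) (hf1 : ∀ w, ‖f w‖ ≤ 1) (hg1 : ∀ w, ‖g w‖ ≤ 1) :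
    HasPolynomialSeries fun s τ => ∫ w, (1 - τ * f w) ^ s * (1 - τ * g w) ^ s ∂μ := by
  refine .of_hasSum (fun k : ℕ × ℕ => k.1 + k.2) finite_preimage_add
    (fun k => Polynomial.C ((∫ w, f w ^ k.1 * g w ^ k.2 ∂μ) / (k.1.factorial * k.2.factorial)) *
      (ascPochhammer ℂ k.1).comp (-Polynomial.X) * (ascPochhammer ℂ k.2).comp (-Polynomial.X))
    fun s τ hτ => ?_
  refine (hasSum_integral_one_sub_mul_cpow hf hg hf1 hg1 s hτ).congr_fun fun k => ?_
  simp only [Polynomial.eval_mul, Polynomial.eval_C, eval_ascPochhammer_comp, Polynomial.eval_neg,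
    Polynomial.eval_X]
  ring

end PolynomialSeries

section Kernel

/-- The two numbers `cos (arccos x ± arccos y)`, for `w = (x, y)` and `ε = ±1`. On the square
`[-1, 1]²` their inverses are the roots of `1 - 2 x y τ + (x² + y² - 1) τ²`, the polynomial in
`τ = tanh α` to which `zonalKernel α x y` reduces after division by `cosh² α`. -/
noncomputable def kernelRoot (ε : ℝ) (w : ℝ × ℝ) : ℝ :=
  Real.cos (Real.arccos w.1 + ε * Real.arccos w.2)

theorem continuous_kernelRoot (ε : ℝ) : Continuous (kernelRoot ε) := by
  unfold kernelRoot
  fun_prop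

theorem abs_kernelRoot_le (ε : ℝ) (w : ℝ × ℝ) : |kernelRoot ε w| ≤ 1 := Real.abs_cos_le_one _

theorem kernelRoot_add {x y : ℝ} (hx : x ∈ Set.Icc (-1 : ℝ) 1) (hy : y ∈ Set.Icc (-1 : ℝ) 1) :
    kernelRoot 1 (x, y) + kernelRoot (-1) (x, y) = 2 * (x * y) := by
  simp only [kernelRoot, one_mul, neg_one_mul, ← sub_eq_add_neg, Real.cos_add, Real.cos_sub,
    Real.cos_arccos hx.1 hx.2, Real.cos_arccos hy.1 hy.2]
  ring

theorem kernelRoot_mul {x y : ℝ} (hx : x ∈ Set.Icc (-1 : ℝ) 1) (hy : y ∈ Set.Icc (-1 : ℝ) 1) :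
    kernelRoot 1 (x, y) * kernelRoot (-1) (x, y) = x ^ 2 + y ^ 2 - 1 := by
  have sin_sq {z : ℝ} (hz : z ∈ Set.Icc (-1 : ℝ) 1) : Real.sin (Real.arccos z) ^ 2 = 1 - z ^ 2 := by
    rw [Real.sin_sq, Real.cos_arccos hz.1 hz.2]
  simp only [kernelRoot, one_mul, neg_one_mul, ← sub_eq_add_neg, Real.cos_add, Real.cos_sub,
    Real.cos_arccos hx.1 hx.2, Real.cos_arccos hy.1 hy.2]
  linear_combination (-Real.sin (Real.arccos y) ^ 2) * sin_sq hx + (x ^ 2 - 1) * sin_sq hy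

/-- The power `(1 - 2 x y τ + (x² + y² - 1) τ²) ^ s`, for `w = (x, y)`, in the factorized form
which is holomorphic in `τ` on the unit disc. -/
noncomputable def kernelPow (s τ : ℂ) (w : ℝ × ℝ) : ℂ :=
  (1 - τ * kernelRoot 1 w) ^ s * (1 - τ * kernelRoot (-1) w) ^ s

theorem kernelPow_natCast (s : ℕ) (τ : ℂ) {w : ℝ × ℝ} (hx : w.1 ∈ Set.Icc (-1 : ℝ) 1)
    (hy : w.2 ∈ Set.Icc (-1 : ℝ) 1) :
    kernelPow s τ w = ((1 - τ ^ 2) * (1 - (w.2 : ℂ) ^ 2) + ((w.2 : ℂ) - τ * w.1) ^ 2) ^ s := by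
  have hadd := congrArg Complex.ofReal (kernelRoot_add hx hy)
  have hmul := congrArg Complex.ofReal (kernelRoot_mul hx hy)
  push_cast at hadd hmul
  rw [kernelPow, Complex.cpow_natCast, Complex.cpow_natCast, ← mul_pow]
  congr 1
  linear_combination (-τ) * hadd + τ ^ 2 * hmul

theorem hasPolynomialSeries_integral_kernelPow (μ : Measure (ℝ × ℝ)) [IsFiniteMeasure μ] :
    HasPolynomialSeries fun s τ => ∫ w, kernelPow s τ w ∂μ := by
  have meas (ε : ℝ) : AEStronglyMeasurable (fun w => (kernelRoot ε w : ℂ)) μ :=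
    (Complex.continuous_ofReal.comp (continuous_kernelRoot ε)).aestronglyMeasurable
  have norm_le_one (ε : ℝ) (w : ℝ × ℝ) : ‖(kernelRoot ε w : ℂ)‖ ≤ 1 :=
    (Complex.norm_real _).trans_le (abs_kernelRoot_le ε w)
  exact hasPolynomialSeries_integral_one_sub_mul_cpow (meas 1) (meas (-1)) (norm_le_one 1)
    (norm_le_one (-1))

theorem ofReal_sq_cpow {c : ℝ} (hc : 0 ≤ c) (z : ℂ) :
    ((c ^ 2 : ℝ) : ℂ) ^ z = (c : ℂ) ^ (2 * z) := by
  have harg : (c : ℂ).arg = 0 := Complex.arg_ofReal_of_nonneg hc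
  rw [Complex.ofReal_pow, Complex.cpow_ofNat_mul' (by simp [harg, Real.pi_pos])
    (by simp [harg, Real.pi_pos.le])]

theorem zonalKernel_eq_mul (α : ℝ) {x y : ℝ} (hx : x ∈ Set.Icc (-1 : ℝ) 1)
    (hy : y ∈ Set.Icc (-1 : ℝ) 1) :
    zonalKernel α x y = (1 - Real.tanh α * kernelRoot 1 (x, y)) *
      (1 - Real.tanh α * kernelRoot (-1) (x, y)) * Real.cosh α ^ 2 := by
  have hadd := kernelRoot_add hx hy
  have hmul := kernelRoot_mul hx hy
  have hsq := Real.cosh_sq α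
  have hsinh : Real.sinh α = Real.tanh α * Real.cosh α := by
    rw [Real.tanh_eq_sinh_div_cosh, div_mul_cancel₀ _ (Real.cosh_pos α).ne']
  rw [zonalKernel, hsinh]
  rw [hsinh] at hsq
  linear_combination (Real.tanh α * Real.cosh α ^ 2) * hadd -
    (Real.tanh α ^ 2 * Real.cosh α ^ 2) * hmul - hsq

theorem one_sub_tanh_mul_kernelRoot_pos (α ε : ℝ) (w : ℝ × ℝ) :
    0 < 1 - Real.tanh α * kernelRoot ε w := by
  have h : |Real.tanh α * kernelRoot ε w| < 1 := by
    rw [abs_mul]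
    exact (mul_le_of_le_one_right (abs_nonneg _) (abs_kernelRoot_le ε w)).trans_lt
      (Real.abs_tanh_lt_one α)
  linarith [(abs_lt.1 h).2]

theorem zonalKernel_cpow (α : ℝ) {x y : ℝ} (hx : x ∈ Set.Icc (-1 : ℝ) 1)
    (hy : y ∈ Set.Icc (-1 : ℝ) 1) (s : ℂ) :
    (zonalKernel α x y : ℂ) ^ s =
      kernelPow s (Real.tanh α) (x, y) * (Real.cosh α : ℂ) ^ (2 * s) := by
  have h1 := one_sub_tanh_mul_kernelRoot_pos α 1 (x, y)
  have h2 := one_sub_tanh_mul_kernelRoot_pos α (-1) (x, y)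
  rw [zonalKernel_eq_mul α hx hy, Complex.ofReal_mul,
    Complex.mul_cpow_ofReal_nonneg (mul_nonneg h1.le h2.le) (sq_nonneg _), Complex.ofReal_mul,
    Complex.mul_cpow_ofReal_nonneg h1.le h2.le, kernelPow, ofReal_sq_cpow (Real.cosh_pos α).le]
  push_cast
  rfl

theorem one_sub_tanh_sq_cpow (α : ℝ) (z : ℂ) :
    (1 - (Real.tanh α : ℂ) ^ 2) ^ (-z) = (Real.cosh α : ℂ) ^ (2 * z) := by
  have hcosh := Real.cosh_pos α
  have hinv : 1 - (Real.tanh α : ℂ) ^ 2 = ((Real.cosh α ^ 2 : ℝ) : ℂ)⁻¹ := by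
    have : 1 - Real.tanh α ^ 2 = (Real.cosh α ^ 2)⁻¹ := by
      rw [Real.tanh_eq_sinh_div_cosh]
      field_simp
      linarith [Real.cosh_sq α]
    exact_mod_cast congrArg Complex.ofReal this
  have harg : ((Real.cosh α ^ 2 : ℝ) : ℂ).arg ≠ Real.pi := by
    rw [Complex.arg_ofReal_of_nonneg (sq_nonneg _)]
    exact Real.pi_pos.ne
  rw [hinv, Complex.inv_cpow _ _ harg, Complex.cpow_neg, inv_inv, ofReal_sq_cpow hcosh.le]

end Kernel

section GegenbauerLaw

/-- A probability measure on `[-1, 1]` with the moments of the density proportional to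
`(1 - x²) ^ (a - 3 / 2)`, the weight of the Gegenbauer polynomials; for `a = p / 2` it is the law of
a coordinate of a uniformly distributed point of the unit sphere of `ℝ^p`. The moments are encoded
by their recurrence relation, which also makes sense at the degenerate parameters `a = 1 / 2` and
`a = 1` of the spheres `S⁰` and `S¹`. -/
structure IsGegenbauerLaw (a : ℝ) (ν : Measure ℝ) : Prop extends IsProbabilityMeasure ν where
  ae_mem : ∀ᵐ x ∂ν, x ∈ Set.Icc (-1 : ℝ) 1
  integral_id : ∫ x, x ∂ν = 0
  integral_pow_add_two (n : ℕ) : (n + 2 * a) * ∫ x, x ^ (n + 2) ∂ν = (n + 1) * ∫ x, x ^ n ∂ν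

namespace IsGegenbauerLaw

variable {a b : ℝ} {ν ν' : Measure ℝ}

theorem ae_mem_prod (h : IsGegenbauerLaw a ν) (h' : IsGegenbauerLaw b ν') :
    ∀ᵐ w ∂ν.prod ν', w.1 ∈ Set.Icc (-1 : ℝ) 1 ∧ w.2 ∈ Set.Icc (-1 : ℝ) 1 := by
  have := h.toIsProbabilityMeasure
  have := h'.toIsProbabilityMeasure
  exact (Measure.quasiMeasurePreserving_fst.ae h.ae_mem).and
    (Measure.quasiMeasurePreserving_snd.ae h'.ae_mem)

theorem integrable {E : Type*} [NormedAddCommGroup E] (h : IsGegenbauerLaw a ν) {f : ℝ → E}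
    (hf : Continuous f) : Integrable f ν := by
  have := h.toIsProbabilityMeasure
  obtain ⟨C, hC⟩ :=
    isCompact_Icc.exists_bound_of_continuousOn (hf.continuousOn (s := Set.Icc (-1) 1))
  exact .of_bound hf.aestronglyMeasurable C (h.ae_mem.mono fun x hx => hC x hx)

theorem integrable_prod {E : Type*} [NormedAddCommGroup E] (h : IsGegenbauerLaw a ν)
    (h' : IsGegenbauerLaw b ν') {f : ℝ × ℝ → E} (hf : Continuous f) :
    Integrable f (ν.prod ν') := by
  have := h.toIsProbabilityMeasure
  have := h'.toIsProbabilityMeasure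
  obtain ⟨C, hC⟩ := (isCompact_Icc.prod isCompact_Icc).exists_bound_of_continuousOn
    (hf.continuousOn (s := Set.Icc (-1) 1 ×ˢ Set.Icc (-1) 1))
  exact .of_bound hf.aestronglyMeasurable C ((h.ae_mem_prod h').mono fun w hw => hC w hw)

theorem half_le (h : IsGegenbauerLaw a ν) : 1 / 2 ≤ a := by
  have := h.toIsProbabilityMeasure
  have second_moment : 2 * a * ∫ x, x ^ 2 ∂ν = 1 := by
    simpa using h.integral_pow_add_two 0
  have second_moment_nonneg : 0 ≤ ∫ x, x ^ 2 ∂ν := integral_nonneg fun x => sq_nonneg x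
  have second_moment_le : ∫ x, x ^ 2 ∂ν ≤ 1 := by
    have sq_le_one : ∀ᵐ x ∂ν, x ^ 2 ≤ 1 :=
      h.ae_mem.mono fun x hx => sq_le_one_iff_abs_le_one x |>.2 (abs_le.2 hx)
    simpa using integral_mono_ae (h.integrable (continuous_pow 2)) (integrable_const 1) sq_le_one
  by_contra! ha
  nlinarith [mul_nonneg (sub_nonneg.2 ha.le) second_moment_nonneg]

theorem re_pos (h : IsGegenbauerLaw a ν) : 0 < (a : ℂ).re := by
  rw [Complex.ofReal_re]
  linarith [h.half_le]

theorem integral_pow_odd (h : IsGegenbauerLaw a ν) (k : ℕ) :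
    ∫ x, (x : ℂ) ^ (2 * k + 1) ∂ν = 0 := by
  have real_moment : ∫ x, x ^ (2 * k + 1) ∂ν = 0 := by
    induction k with
    | zero => simpa using h.integral_id
    | succ k ih =>
      have hrec := h.integral_pow_add_two (2 * k + 1)
      rw [ih, mul_zero] at hrec
      have hpos : (((2 * k + 1 : ℕ) : ℝ) + 2 * a) ≠ 0 := by
        have := h.half_le
        positivity
      exact (mul_eq_zero.1 hrec).resolve_left hpos
  simp only [← Complex.ofReal_pow, integral_complex_ofReal, real_moment, Complex.ofReal_zero]

theorem integral_pow_even (h : IsGegenbauerLaw a ν) (k : ℕ) :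
    ∫ x, (x : ℂ) ^ (2 * k) ∂ν = pochhammerSymbol (1 / 2) k / pochhammerSymbol a k := by
  have := h.toIsProbabilityMeasure
  induction k with
  | zero => simp [pochhammerSymbol_zero]
  | succ k ih =>
    have hrec := congrArg Complex.ofReal (h.integral_pow_add_two (2 * k))
    simp only [Complex.ofReal_mul, ← integral_complex_ofReal, Complex.ofReal_pow] at hrec
    rw [ih] at hrec
    have hk := pochhammerSymbol_ne_zero h.re_pos (k + 1)
    rw [pochhammerSymbol_succ] at hk
    rw [pochhammerSymbol_succ, pochhammerSymbol_succ, eq_div_iff hk, mul_add 2 k 1, mul_one]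
    have := left_ne_zero_of_mul hk
    field_simp at hrec
    push_cast at hrec
    linear_combination hrec / 2

theorem integral_one_sub_sq_pow_mul (h : IsGegenbauerLaw a ν) (i j : ℕ) :
    ∫ x, (1 - (x : ℂ) ^ 2) ^ i * (x : ℂ) ^ (2 * j) ∂ν =
      pochhammerSymbol (a - 1 / 2) i * pochhammerSymbol (1 / 2) j / pochhammerSymbol a (i + j) := by
  induction i generalizing j with
  | zero => simp [pochhammerSymbol_zero, h.integral_pow_even]
  | succ i ih =>
    have expand (x : ℝ) : (1 - (x : ℂ) ^ 2) ^ (i + 1) * (x : ℂ) ^ (2 * j) =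
        (1 - (x : ℂ) ^ 2) ^ i * (x : ℂ) ^ (2 * j) -
          (1 - (x : ℂ) ^ 2) ^ i * (x : ℂ) ^ (2 * (j + 1)) := by
      ring
    have hne := pochhammerSymbol_ne_zero h.re_pos (i + j + 1)
    rw [pochhammerSymbol_succ] at hne
    simp only [expand]
    rw [integral_sub (h.integrable (by fun_prop)) (h.integrable (by fun_prop)), ih, ih,
      ← add_assoc, add_right_comm i 1 j, pochhammerSymbol_succ _ (i + j), pochhammerSymbol_succ _ i,
      pochhammerSymbol_succ _ j]
    have := left_ne_zero_of_mul hne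
    have := right_ne_zero_of_mul hne
    field_simp
    push_cast
    ring

end IsGegenbauerLaw

theorem sum_antidiagonal_two_mul {f : ℕ × ℕ → ℂ} (hf : ∀ k j, f (2 * k + 1, j) = 0) (n : ℕ) :
    ∑ ij ∈ antidiagonal (2 * n), f ij = ∑ ij ∈ antidiagonal n, f (2 * ij.1, 2 * ij.2) := by
  refine (Finset.sum_of_injOn (fun ij : ℕ × ℕ => (2 * ij.1, 2 * ij.2)) (fun x _ y _ hxy => ?_)
    (fun ij hij => ?_) (fun ij hij hnot => ?_) fun _ _ => rfl).symm
  · simp only [Prod.mk.injEq] at hxy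
    ext <;> omega
  · simp only [SetLike.mem_coe, mem_antidiagonal] at hij ⊢
    omega
  · rcases Nat.even_or_odd' ij.1 with ⟨k, hk | hk⟩
    · simp only [mem_antidiagonal] at hij
      refine (hnot ⟨(k, n - k), ?_, ?_⟩).elim
      · simp only [SetLike.mem_coe, mem_antidiagonal]; omega
      · ext <;> dsimp only <;> omega
    · rw [← hf k ij.2, ← hk]

theorem choose_two_mul_two_mul (m j : ℕ) :
    ((2 * (m + j)).choose (2 * m) : ℂ) * pochhammerSymbol (1 / 2) m =
      (m + j).factorial * pochhammerSymbol (1 / 2) (m + j) /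
        (m.factorial * j.factorial * pochhammerSymbol (1 / 2) j) := by
  have hm := pochhammerSymbol_half_ne_zero m
  have hj := pochhammerSymbol_half_ne_zero j
  have hm' : (m.factorial : ℂ) ≠ 0 := Nat.cast_ne_zero.2 m.factorial_ne_zero
  have hj' : (j.factorial : ℂ) ≠ 0 := Nat.cast_ne_zero.2 j.factorial_ne_zero
  rw [mul_add, Nat.cast_add_choose, ← mul_add, factorial_two_mul, factorial_two_mul,
    factorial_two_mul, pow_add]
  field_simp

namespace IsGegenbauerLaw

variable {a b : ℝ} {ν ν' : Measure ℝ}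

theorem integral_sub_mul_pow (h : IsGegenbauerLaw a ν) (y τ : ℂ) (M : ℕ) :
    ∫ x, (y - τ * x) ^ (2 * M) ∂ν = ∑ mj ∈ antidiagonal M,
      M.factorial * pochhammerSymbol (1 / 2) M * (τ ^ 2) ^ mj.1 /
        (mj.1.factorial * mj.2.factorial * pochhammerSymbol (1 / 2) mj.2 *
          pochhammerSymbol a mj.1) * y ^ (2 * mj.2) := by
  have expand (x : ℝ) : (y - τ * x) ^ (2 * M) = ∑ kl ∈ antidiagonal (2 * M),
      (2 * M).choose kl.1 * (-τ) ^ kl.1 * y ^ kl.2 * (x : ℂ) ^ kl.1 := by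
    rw [sub_eq_neg_add, (Commute.all _ _).add_pow']
    refine Finset.sum_congr rfl fun kl _ => ?_
    rw [nsmul_eq_mul, ← neg_mul, mul_pow]
    ring
  simp only [expand]
  rw [integral_finsetSum _ fun kl _ => h.integrable (by fun_prop)]
  simp only [integral_const_mul]
  rw [sum_antidiagonal_two_mul fun k j => by rw [h.integral_pow_odd, mul_zero]]
  refine Finset.sum_congr rfl fun mj hmj => ?_
  have hchoose := choose_two_mul_two_mul mj.1 mj.2
  rw [mem_antidiagonal.1 hmj] at hchoose
  rw [h.integral_pow_even, pow_mul, neg_sq]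
  linear_combination ((τ ^ 2) ^ mj.1 * y ^ (2 * mj.2) / pochhammerSymbol a mj.1) * hchoose

theorem integral_one_sub_sq_mul_sub_pow (h : IsGegenbauerLaw a ν) (h' : IsGegenbauerLaw b ν')
    (τ : ℂ) (i M : ℕ) :
    ∫ w : ℝ × ℝ, (1 - (w.2 : ℂ) ^ 2) ^ i * ((w.2 : ℂ) - τ * w.1) ^ (2 * M) ∂ν.prod ν' =
      ∑ mj ∈ antidiagonal M, M.factorial * pochhammerSymbol (1 / 2) M *
        (pochhammerSymbol (b - 1 / 2) i * (τ ^ 2) ^ mj.1 /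
          (mj.1.factorial * mj.2.factorial * (pochhammerSymbol a mj.1 *
            pochhammerSymbol b (i + mj.2)))) := by
  have := h.toIsProbabilityMeasure
  have := h'.toIsProbabilityMeasure
  rw [integral_prod_symm _ (h.integrable_prod h' (by fun_prop))]
  simp only [integral_const_mul, h.integral_sub_mul_pow, Finset.mul_sum, mul_left_comm _ (_ / _)]
  rw [integral_finsetSum _ fun mj _ => h'.integrable (by fun_prop)]
  refine Finset.sum_congr rfl fun mj _ => ?_
  have := pochhammerSymbol_half_ne_zero mj.2
  rw [integral_const_mul, h'.integral_one_sub_sq_pow_mul]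
  field_simp

theorem integral_kernelPow_natCast (h : IsGegenbauerLaw a ν) (h' : IsGegenbauerLaw b ν') (s : ℕ)
    (τ : ℂ) :
    ∫ w, kernelPow s τ w ∂ν.prod ν' = s.factorial * ∑ iM ∈ antidiagonal s,
      ∑ mj ∈ antidiagonal iM.2, zonalPolynomialTerm a b (τ ^ 2) iM.1 mj.2 mj.1 := by
  have expand : ∀ᵐ w ∂ν.prod ν', kernelPow s τ w = ∑ iM ∈ antidiagonal s,
      s.choose iM.1 * (1 - τ ^ 2) ^ iM.1 *
        ((1 - (w.2 : ℂ) ^ 2) ^ iM.1 * ((w.2 : ℂ) - τ * w.1) ^ (2 * iM.2)) := by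
    filter_upwards [h.ae_mem_prod h'] with w hw
    rw [kernelPow_natCast s τ hw.1 hw.2, (Commute.all _ _).add_pow']
    refine Finset.sum_congr rfl fun iM _ => ?_
    rw [nsmul_eq_mul, mul_pow, pow_mul]
    ring
  rw [integral_congr_ae expand, integral_finsetSum _ fun iM _ => h.integrable_prod h' (by fun_prop),
    Finset.mul_sum]
  refine Finset.sum_congr rfl fun iM hiM => ?_
  rw [integral_const_mul, h.integral_one_sub_sq_mul_sub_pow h', Finset.mul_sum, Finset.mul_sum]
  refine Finset.sum_congr rfl fun mj hmj => ?_
  have hi : (iM.1.factorial : ℂ) ≠ 0 := Nat.cast_ne_zero.2 iM.1.factorial_ne_zero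
  have hM : (iM.2.factorial : ℂ) ≠ 0 := Nat.cast_ne_zero.2 iM.2.factorial_ne_zero
  rw [← mem_antidiagonal.1 hiM, Nat.cast_add_choose, zonalPolynomialTerm, mem_antidiagonal.1 hmj]
  field_simp

end IsGegenbauerLaw

theorem sum_antidiagonal_rotate {R : Type*} [AddCommMonoid R] (f : ℕ → ℕ → ℕ → R) (s : ℕ) :
    ∑ mr ∈ antidiagonal s, ∑ ij ∈ antidiagonal mr.2, f ij.1 ij.2 mr.1 =
      ∑ ir ∈ antidiagonal s, ∑ mj ∈ antidiagonal ir.2, f ir.1 mj.2 mj.1 := by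
  rw [Finset.sum_sigma', Finset.sum_sigma']
  refine Finset.sum_nbij' (fun k => ⟨(k.2.1, k.1.1 + k.2.2), (k.1.1, k.2.2)⟩)
    (fun k => ⟨(k.2.1, k.1.1 + k.2.2), (k.1.1, k.2.2)⟩) ?_ ?_ ?_ ?_ ?_ <;>
  · rintro ⟨⟨m, r⟩, i, j⟩ h
    grind [mem_antidiagonal]

namespace IsGegenbauerLaw

variable {a b : ℝ} {ν ν' : Measure ℝ}

theorem integral_kernelPow_mul_eq_tsum (h : IsGegenbauerLaw a ν) (h' : IsGegenbauerLaw b ν')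
    (s : ℂ) {τ : ℂ} (hτ : ‖τ‖ < 1) :
    (∫ w, kernelPow s τ w ∂ν.prod ν') * (1 - τ ^ 2) ^ (-(s + 1 / 2)) =
      ∑' k, zonalTerm a b s (τ ^ 2) k := by
  have := h.toIsProbabilityMeasure
  have := h'.toIsProbabilityMeasure
  have hb : 1 / 2 ≤ (b : ℂ).re := h'.half_le
  have binomial : HasPolynomialSeries fun s τ => (1 - τ ^ 2) ^ (-(s + 1 / 2)) := by
    have := hasPolynomialSeries_one_sub_cpow (Polynomial.X + Polynomial.C (1 / 2))
    simp only [Polynomial.eval_add, Polynomial.eval_X, Polynomial.eval_C] at this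
    exact this.comp_pow two_ne_zero
  refine ((hasPolynomialSeries_integral_kernelPow (ν.prod ν')).mul binomial).eq_of_natCast
    ((hasPolynomialSeries_tsum_zonalTerm a hb).comp_pow two_ne_zero) (fun s τ hτ => ?_) s hτ
  rw [h.integral_kernelPow_natCast h', tsum_zonalTerm_natCast a hb s
    (norm_pow τ 2 ▸ pow_lt_one₀ (norm_nonneg _) hτ two_ne_zero), sum_antidiagonal_rotate]
  ring

theorem integral_zonalKernel_cpow_eq_tsum (h : IsGegenbauerLaw a ν) (h' : IsGegenbauerLaw b ν')
    (s : ℂ) (α : ℝ) :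
    ∫ w, (zonalKernel α w.1 w.2 : ℂ) ^ s ∂ν.prod ν' =
      1 / (Real.cosh α : ℂ) * ∑' k, zonalTerm a b s ((Real.tanh α : ℂ) ^ 2) k := by
  have norm_tanh_lt_one : ‖(Real.tanh α : ℂ)‖ < 1 :=
    (Complex.norm_real _).trans_lt (Real.abs_tanh_lt_one α)
  have hcosh : (Real.cosh α : ℂ) ≠ 0 := Complex.ofReal_ne_zero.2 (Real.cosh_pos α).ne'
  rw [integral_congr_ae ((h.ae_mem_prod h').mono fun w hw => zonalKernel_cpow α hw.1 hw.2 s),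
    integral_mul_const, ← h.integral_kernelPow_mul_eq_tsum h' s norm_tanh_lt_one,
    one_sub_tanh_sq_cpow, mul_add, mul_one_div_cancel two_ne_zero, Complex.cpow_add _ _ hcosh,
    Complex.cpow_one]
  field_simp

end IsGegenbauerLaw

end GegenbauerLaw

section GaussianMoments

theorem integrable_pow_mul_exp_neg_sq (n : ℕ) :
    Integrable fun x : ℝ => x ^ n * Real.exp (-x ^ 2) := by
  simpa only [Real.rpow_natCast, neg_one_mul] using
    integrable_rpow_mul_exp_neg_mul_sq one_pos (neg_one_lt_zero.trans_le n.cast_nonneg)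

theorem integral_pow_add_two_mul_exp_neg_sq (n : ℕ) :
    ∫ x : ℝ, x ^ (n + 2) * Real.exp (-x ^ 2) =
      (n + 1) / 2 * ∫ x : ℝ, x ^ n * Real.exp (-x ^ 2) := by
  have hderiv (x : ℝ) : HasDerivAt (fun x => x ^ (n + 1) * Real.exp (-x ^ 2))
      ((n + 1) * (x ^ n * Real.exp (-x ^ 2)) - 2 * (x ^ (n + 2) * Real.exp (-x ^ 2))) x := by
    refine ((hasDerivAt_pow (n + 1) x).mul (hasDerivAt_pow 2 x).fun_neg.exp).congr_deriv ?_
    push_cast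
    ring
  have hn := (integrable_pow_mul_exp_neg_sq n).const_mul (n + 1 : ℝ)
  have hn2 := (integrable_pow_mul_exp_neg_sq (n + 2)).const_mul 2
  have by_parts := integral_eq_zero_of_hasDerivAt_of_integrable hderiv (hn.sub hn2)
    (integrable_pow_mul_exp_neg_sq (n + 1))
  rw [integral_sub hn hn2, integral_const_mul, integral_const_mul] at by_parts
  linarith

theorem integral_id_mul_exp_neg_sq : ∫ x : ℝ, x * Real.exp (-x ^ 2) = 0 := by
  have h := integral_neg_eq_self (fun x : ℝ => x * Real.exp (-x ^ 2)) volume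
  simp only [neg_sq, neg_mul, integral_neg] at h
  linarith

theorem integral_Ioi_pow_mul_exp_neg_sq (n : ℕ) :
    ∫ r in Set.Ioi (0 : ℝ), r ^ n * Real.exp (-r ^ 2) = Real.Gamma ((n + 1) / 2) / 2 := by
  have h := integral_rpow_mul_exp_neg_rpow two_pos (neg_one_lt_zero.trans_le n.cast_nonneg)
  simp only [Real.rpow_natCast, Real.rpow_two] at h
  rw [h]
  ring

end GaussianMoments

section Sphere

theorem integral_mul_norm_of_homogeneous {E : Type*} [NormedAddCommGroup E] [NormedSpace ℝ E]
    [FiniteDimensional ℝ E] [Nontrivial E] [MeasurableSpace E] [BorelSpace E] (μ : Measure E)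
    [μ.IsAddHaarMeasure] {F : E → ℝ} {n : ℕ}
    (hF : ∀ (r : ℝ) (x : E), 0 < r → F (r • x) = r ^ n * F x) (g : ℝ → ℝ) :
    ∫ x, F x * g ‖x‖ ∂μ = (∫ θ : Metric.sphere (0 : E) 1, F θ ∂μ.toSphere) *
      ∫ r in Set.Ioi 0, r ^ (Module.finrank ℝ E - 1 + n) * g r := by
  set d := Module.finrank ℝ E - 1
  calc
    ∫ x, F x * g ‖x‖ ∂μ = ∫ x : ({0}ᶜ : Set E), F x * g ‖x.1‖ ∂μ.comap (↑) := by
      rw [integral_subtype_comap (measurableSet_singleton _).compl fun x => F x * g ‖x‖,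
        restrict_compl_singleton]
    _ = ∫ z, F z.1 * (z.2.1 ^ n * g z.2) ∂μ.toSphere.prod (.volumeIoiPow d) := by
      rw [← μ.measurePreserving_homeomorphUnitSphereProd.integral_comp
        (Homeomorph.measurableEmbedding _)]
      refine integral_congr_ae (.of_forall fun x => ?_)
      have hx : 0 < ‖x.1‖ := norm_pos_iff.2 x.2
      simp only [homeomorphUnitSphereProd_apply_fst_coe, homeomorphUnitSphereProd_apply_snd_coe,
        hF _ _ (inv_pos.2 hx), inv_pow]
      field_simp
    _ = (∫ θ : Metric.sphere (0 : E) 1, F θ ∂μ.toSphere) *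
        ∫ r : Set.Ioi (0 : ℝ), r.1 ^ n * g r ∂.volumeIoiPow d :=
      integral_prod_mul (fun θ : Metric.sphere (0 : E) 1 => F θ)
        fun r : Set.Ioi (0 : ℝ) => r.1 ^ n * g r
    _ = _ := by
      congr 1
      simp only [Measure.volumeIoiPow, ENNReal.ofReal]
      rw [integral_withDensity_eq_integral_smul (measurable_subtype_coe.pow_const d).real_toNNReal,
        integral_subtype_comap measurableSet_Ioi fun r => (r ^ d).toNNReal • (r ^ n * g r)]
      refine setIntegral_congr_fun measurableSet_Ioi fun r hr => ?_
      rw [NNReal.smul_def, Real.coe_toNNReal _ (pow_nonneg (Set.mem_Ioi.1 hr).le _), smul_eq_mul,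
        pow_add, mul_assoc]

variable (p : ℕ) [NeZero p]

local notation "𝔼" => EuclideanSpace ℝ (Fin p)

theorem integral_apply_zero_pow_mul_exp_neg_norm_sq (n : ℕ) :
    ∫ x : 𝔼, x 0 ^ n * Real.exp (-‖x‖ ^ 2) =
      (∫ x : ℝ, x ^ n * Real.exp (-x ^ 2)) *
        ∏ _i ∈ Finset.univ.erase (0 : Fin p), ∫ x : ℝ, Real.exp (-x ^ 2) := by
  let f (i : Fin p) (x : ℝ) : ℝ := (if i = 0 then x ^ n else 1) * Real.exp (-x ^ 2)
  have eq_prod (x : 𝔼) : x 0 ^ n * Real.exp (-‖x‖ ^ 2) = ∏ i, f i (x i) := by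
    simp only [f, Finset.prod_mul_distrib, Finset.prod_ite_eq', Finset.mem_univ, if_true,
      ← Real.exp_sum, EuclideanSpace.norm_sq_eq, Finset.sum_neg_distrib, Real.norm_eq_abs, sq_abs]
  simp only [eq_prod]
  rw [(PiLp.volume_preserving_ofLp (Fin p)).integral_comp
      (MeasurableEquiv.toLp 2 (Fin p → ℝ)).symm.measurableEmbedding fun x => ∏ i, f i (x i),
    integral_fintype_prod_volume_eq_prod, ← Finset.mul_prod_erase _ _ (Finset.mem_univ 0)]
  refine congrArg₂ (· * ·) ?_ (Finset.prod_congr rfl fun i hi => ?_)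
  · simp only [f, if_true]
  · simp only [f, if_neg (Finset.ne_of_mem_erase hi), one_mul]

theorem integral_sphere_apply_zero_pow_mul_Gamma (n : ℕ) :
    (∫ θ : Metric.sphere (0 : 𝔼) 1, θ.1 0 ^ n ∂(volume : Measure 𝔼).toSphere) *
        (Real.Gamma ((p + n) / 2) / 2) =
      (∫ x : ℝ, x ^ n * Real.exp (-x ^ 2)) *
        ∏ _i ∈ Finset.univ.erase (0 : Fin p), ∫ x : ℝ, Real.exp (-x ^ 2) := by
  have : Nonempty (Fin p) := ⟨0⟩
  have hdim : ((p - 1 + n : ℕ) + 1 : ℝ) = p + n := by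
    exact_mod_cast (by have := NeZero.one_le (n := p); omega : p - 1 + n + 1 = p + n)
  rw [← integral_apply_zero_pow_mul_exp_neg_norm_sq, ← hdim, ← integral_Ioi_pow_mul_exp_neg_sq,
    integral_mul_norm_of_homogeneous volume (F := fun x : 𝔼 => x 0 ^ n)
      (fun r x _ => by rw [PiLp.smul_apply, smul_eq_mul, mul_pow]) fun r => Real.exp (-r ^ 2),
    finrank_euclideanSpace_fin]

theorem integral_sphere_apply_zero :
    ∫ θ : Metric.sphere (0 : 𝔼) 1, θ.1 0 ∂(volume : Measure 𝔼).toSphere = 0 := by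
  have h := integral_sphere_apply_zero_pow_mul_Gamma p 1
  simp only [pow_one, integral_id_mul_exp_neg_sq, zero_mul] at h
  have := Real.Gamma_pos_of_pos (show (0 : ℝ) < (p + (1 : ℕ)) / 2 by positivity)
  exact (mul_eq_zero.1 h).resolve_right (by positivity)

theorem integral_sphere_apply_zero_pow_add_two (n : ℕ) :
    (n + p) * ∫ θ : Metric.sphere (0 : 𝔼) 1, θ.1 0 ^ (n + 2) ∂(volume : Measure 𝔼).toSphere =
      (n + 1) * ∫ θ : Metric.sphere (0 : 𝔼) 1, θ.1 0 ^ n ∂(volume : Measure 𝔼).toSphere := by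
  have moment := integral_sphere_apply_zero_pow_mul_Gamma p n
  have moment_add_two := integral_sphere_apply_zero_pow_mul_Gamma p (n + 2)
  have hpos : (0 : ℝ) < (p + n) / 2 := by
    have : (0 : ℝ) < p := Nat.cast_pos.2 (NeZero.pos p)
    positivity
  have hshift : (p + (n + 2 : ℕ) : ℝ) / 2 = (p + n) / 2 + 1 := by
    push_cast
    ring
  rw [hshift, Real.Gamma_add_one hpos.ne', integral_pow_add_two_mul_exp_neg_sq] at moment_add_two
  refine mul_right_cancel₀ (Real.Gamma_pos_of_pos hpos).ne' ?_
  linear_combination 4 * moment_add_two - 2 * (n + 1) * moment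

/-- The law of the first coordinate of a uniformly distributed point of the unit sphere of `ℝ^p`. -/
noncomputable def sphereLaw : Measure ℝ :=
  ((volume : Measure 𝔼).toSphere Set.univ)⁻¹ •
    (volume : Measure 𝔼).toSphere.map fun θ => θ.1 0

theorem isGegenbauerLaw_sphereLaw : IsGegenbauerLaw (p / 2) (sphereLaw p) := by
  have : Nonempty (Fin p) := ⟨0⟩
  set μ := (volume : Measure 𝔼).toSphere
  have hm : Measurable fun θ : Metric.sphere (0 : 𝔼) 1 => θ.1 0 := by fun_prop
  have integral_pow (n : ℕ) :
      ∫ x, x ^ n ∂sphereLaw p = (μ Set.univ)⁻¹.toReal * ∫ θ, θ.1 0 ^ n ∂μ := by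
    rw [sphereLaw, integral_smul_measure, integral_map hm.aemeasurable (by fun_prop), smul_eq_mul]
  refine ⟨⟨?_⟩, ?_, ?_, fun n => ?_⟩
  · rw [sphereLaw, Measure.smul_apply, Measure.map_apply hm .univ, Set.preimage_univ, smul_eq_mul]
    exact ENNReal.inv_mul_cancel (Measure.measure_univ_ne_zero.2 (Measure.toSphere_ne_zero _))
      (measure_ne_top _ _)
  · refine Measure.ae_smul_measure ((ae_map_iff hm.aemeasurable measurableSet_Icc).2 <|
      .of_forall fun θ => abs_le.1 ?_) _
    simpa only [norm_eq_of_mem_sphere θ, Real.norm_eq_abs] using PiLp.norm_apply_le θ.1 0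
  · simpa only [pow_one, integral_sphere_apply_zero p, mul_zero, μ] using integral_pow 1
  · rw [integral_pow, integral_pow, mul_div_cancel₀ _ two_ne_zero]
    linear_combination (μ Set.univ)⁻¹.toReal * integral_sphere_apply_zero_pow_add_two p n

end Sphere

section CosLaw

/-- The law of `cos φ` for `φ` uniformly distributed in `[0, 2π]`. -/
noncomputable def cosLaw : Measure ℝ :=
  ENNReal.ofReal (2 * Real.pi)⁻¹ •
    (volume.restrict (Set.Ioc 0 (2 * Real.pi))).map Real.cos

theorem integral_cosLaw {E : Type*} [NormedAddCommGroup E] [NormedSpace ℝ E] {f : ℝ → E}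
    (hf : AEStronglyMeasurable f ((volume.restrict (Set.Ioc 0 (2 * Real.pi))).map Real.cos)) :
    ∫ x, f x ∂cosLaw = (2 * Real.pi)⁻¹ • ∫ φ in 0..2 * Real.pi, f (Real.cos φ) := by
  have := Real.pi_pos
  rw [cosLaw, integral_smul_measure, integral_map Real.measurable_cos.aemeasurable hf,
    ENNReal.toReal_ofReal (by positivity), intervalIntegral.integral_of_le (by positivity)]

theorem isGegenbauerLaw_cosLaw : IsGegenbauerLaw 1 cosLaw := by
  have := Real.pi_pos
  refine ⟨⟨?_⟩, ?_, ?_, fun n => ?_⟩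
  · rw [cosLaw, Measure.smul_apply, Measure.map_apply Real.measurable_cos .univ, Set.preimage_univ,
      Measure.restrict_apply_univ, Real.volume_Ioc, sub_zero, smul_eq_mul,
      ← ENNReal.ofReal_mul (by positivity), inv_mul_cancel₀ (by positivity), ENNReal.ofReal_one]
  · exact Measure.ae_smul_measure ((ae_map_iff Real.measurable_cos.aemeasurable
      measurableSet_Icc).2 <| .of_forall Real.cos_mem_Icc) _
  · rw [integral_cosLaw (by fun_prop), integral_cos, Real.sin_two_pi, Real.sin_zero, sub_zero,
      smul_zero]
  · rw [integral_cosLaw (by fun_prop), integral_cosLaw (by fun_prop), integral_cos_pow,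
      Real.sin_two_pi, Real.sin_zero]
    simp only [smul_eq_mul]
    field_simp
    ring

end CosLaw

section GegenbauerMeasure

theorem integral_rpow_mul_one_sub_rpow {u v : ℝ} (hu : 0 < u) (hv : 0 < v) :
    ∫ t in (0 : ℝ)..1, t ^ (u - 1) * (1 - t) ^ (v - 1) =
      Real.Gamma u * Real.Gamma v / Real.Gamma (u + v) := by
  have h := Complex.betaIntegral_eq_Gamma_mul_div u v hu hv
  rw [← Complex.ofReal_inj, ← intervalIntegral.integral_ofReal]
  push_cast [← Complex.Gamma_ofReal]
  rw [← h, Complex.betaIntegral]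
  refine intervalIntegral.integral_congr fun t ht => ?_
  rw [Set.uIcc_of_le zero_le_one] at ht
  simp only [Complex.ofReal_cpow ht.1, Complex.ofReal_cpow (sub_nonneg.2 ht.2)]
  push_cast
  rfl

theorem integral_one_sub_sq_rpow {u : ℝ} (hu : 0 < u) :
    ∫ x in (-1 : ℝ)..1, (1 - x ^ 2) ^ (u - 1) =
      √Real.pi * Real.Gamma u / Real.Gamma (u + 1 / 2) := by
  have substitution : ∫ t in (0 : ℝ)..1, (1 - (2 * t - 1) ^ 2) ^ (u - 1) =
      2⁻¹ * ∫ x in (-1 : ℝ)..1, (1 - x ^ 2) ^ (u - 1) := by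
    rw [intervalIntegral.integral_comp_mul_sub (fun x : ℝ => (1 - x ^ 2) ^ (u - 1)) two_ne_zero]
    norm_num
  have rescale : ∫ t in (0 : ℝ)..1, (1 - (2 * t - 1) ^ 2) ^ (u - 1) =
      4 ^ (u - 1) * ∫ t in (0 : ℝ)..1, t ^ (u - 1) * (1 - t) ^ (u - 1) := by
    rw [← intervalIntegral.integral_const_mul]
    refine intervalIntegral.integral_congr fun t ht => ?_
    rw [Set.uIcc_of_le zero_le_one] at ht
    have ht' : 0 ≤ 1 - t := sub_nonneg.2 ht.2
    rw [← Real.mul_rpow ht.1 ht', ← Real.mul_rpow zero_le_four (mul_nonneg ht.1 ht')]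
    ring_nf
  have powers : (4 : ℝ) ^ (u - 1) * 2 ^ (1 - 2 * u) = 2⁻¹ := by
    rw [show (4 : ℝ) = 2 ^ (2 : ℝ) by norm_num, ← Real.rpow_mul zero_le_two,
      ← Real.rpow_add two_pos, show 2 * (u - 1) + (1 - 2 * u) = -1 by ring, Real.rpow_neg_one]
  have legendre := Real.Gamma_mul_Gamma_add_half u
  have hΓ := (Real.Gamma_pos_of_pos (show 0 < 2 * u by positivity)).ne'
  have hΓ' := (Real.Gamma_pos_of_pos (show 0 < u + 1 / 2 by positivity)).ne'
  calc ∫ x in (-1 : ℝ)..1, (1 - x ^ 2) ^ (u - 1)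
      = 2 * 4 ^ (u - 1) * (Real.Gamma u * Real.Gamma u / Real.Gamma (2 * u)) := by
        rw [two_mul u, ← integral_rpow_mul_one_sub_rpow hu hu]
        linear_combination 2 * rescale - 2 * substitution
    _ = √Real.pi * Real.Gamma u / Real.Gamma (u + 1 / 2) := by
        rw [← mul_div_assoc, div_eq_div_iff hΓ hΓ']
        linear_combination (2 * 4 ^ (u - 1) * Real.Gamma u) * legendre +
          (2 * Real.Gamma u * Real.Gamma (2 * u) * √Real.pi) * powers

theorem intervalIntegrable_one_sub_sq_rpow {u : ℝ} (hu : 0 < u) :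
    IntervalIntegrable (fun x : ℝ => (1 - x ^ 2) ^ (u - 1)) volume (-1) 1 := by
  -- The integral of a function which is not integrable is `0`, whereas this one is positive.
  have := Real.Gamma_pos_of_pos hu
  have := Real.Gamma_pos_of_pos (show 0 < u + 1 / 2 by positivity)
  have := Real.pi_pos
  refine not_imp_comm.1 intervalIntegral.integral_undef ?_
  rw [integral_one_sub_sq_rpow hu]
  positivity

theorem integral_pow_add_two_mul_one_sub_sq_rpow {u : ℝ} (hu : 0 < u) (n : ℕ) :
    (n + 2 * u + 1) * ∫ x in (-1 : ℝ)..1, x ^ (n + 2) * (1 - x ^ 2) ^ (u - 1) =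
      (n + 1) * ∫ x in (-1 : ℝ)..1, x ^ n * (1 - x ^ 2) ^ (u - 1) := by
  have integrable (k : ℕ) (c : ℝ) :
      IntervalIntegrable (fun x : ℝ => c * (x ^ k * (1 - x ^ 2) ^ (u - 1))) volume (-1) 1 :=
    ((intervalIntegrable_one_sub_sq_rpow hu).continuousOn_mul (by fun_prop)).const_mul c
  have hcont : ContinuousOn (fun x : ℝ => x ^ (n + 1) * (1 - x ^ 2) ^ u) (Set.Icc (-1) 1) :=
    (Continuous.mul (by fun_prop) (.rpow_const (by fun_prop) fun _ => .inr hu.le)).continuousOn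
  have hderiv : ∀ x ∈ Set.Ioo (-1 : ℝ) 1, HasDerivAt (fun x : ℝ => x ^ (n + 1) * (1 - x ^ 2) ^ u)
      ((n + 1) * (x ^ n * (1 - x ^ 2) ^ (u - 1)) -
        (n + 2 * u + 1) * (x ^ (n + 2) * (1 - x ^ 2) ^ (u - 1))) x := by
    intro x hx
    have hpos : 0 < 1 - x ^ 2 := sub_pos.2 ((sq_lt_one_iff_abs_lt_one x).2 (abs_lt.2 hx))
    refine ((hasDerivAt_pow (n + 1) x).mul
      (((hasDerivAt_pow 2 x).const_sub 1).rpow_const (.inl hpos.ne'))).congr_deriv ?_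
    have hsplit : (1 - x ^ 2) ^ u = (1 - x ^ 2) ^ (u - 1) * (1 - x ^ 2) := by
      rw [← Real.rpow_add_one hpos.ne', sub_add_cancel]
    rw [hsplit]
    push_cast
    ring
  have by_parts := intervalIntegral.integral_eq_sub_of_hasDerivAt_of_le (by norm_num) hcont hderiv
    ((integrable _ _).sub (integrable _ _))
  rw [intervalIntegral.integral_sub (integrable _ _) (integrable _ _),
    intervalIntegral.integral_const_mul, intervalIntegral.integral_const_mul, neg_one_sq, one_pow 2,
    sub_self, Real.zero_rpow hu.ne', mul_zero, mul_zero, sub_zero] at by_parts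
  linarith

theorem integral_id_mul_one_sub_sq_rpow (e : ℝ) :
    ∫ x in (-1 : ℝ)..1, x * (1 - x ^ 2) ^ e = 0 := by
  have h := intervalIntegral.integral_comp_neg (a := -1) (b := 1)
    fun x : ℝ => x * (1 - x ^ 2) ^ e
  simp only [neg_sq, neg_mul, intervalIntegral.integral_neg, neg_neg] at h
  linarith

/-- The normalization constant of the weight `(1 - x²) ^ (a - 3 / 2)` on `[-1, 1]`. -/
noncomputable def gegenbauerConstant (a : ℝ) : ℝ :=
  Real.Gamma a / (√Real.pi * Real.Gamma (a - 1 / 2))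

/-- The probability measure on `[-1, 1]` with density proportional to `(1 - x²) ^ (a - 3 / 2)`. -/
noncomputable def gegenbauerMeasure (a : ℝ) : Measure ℝ :=
  (volume.restrict (Set.Ioc (-1) 1)).withDensity fun x =>
    ENNReal.ofReal (gegenbauerConstant a * (1 - x ^ 2) ^ (a - 3 / 2))

variable {a : ℝ}

theorem gegenbauerConstant_pos (ha : 1 / 2 < a) : 0 < gegenbauerConstant a := by
  have := Real.Gamma_pos_of_pos (show 0 < a by linarith)
  have := Real.Gamma_pos_of_pos (sub_pos.2 ha)
  have := Real.pi_pos
  unfold gegenbauerConstant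
  positivity

theorem gegenbauerConstant_mul_integral (ha : 1 / 2 < a) :
    gegenbauerConstant a * ∫ x in (-1 : ℝ)..1, (1 - x ^ 2) ^ (a - 3 / 2) = 1 := by
  have hconst := (gegenbauerConstant_pos ha).ne'
  have h := integral_one_sub_sq_rpow (sub_pos.2 ha)
  rw [show a - 1 / 2 - 1 = a - 3 / 2 by ring, sub_add_cancel] at h
  rw [h, ← inv_div, ← gegenbauerConstant, mul_inv_cancel₀ hconst]

theorem one_sub_sq_nonneg {x : ℝ} (hx : x ∈ Set.Ioc (-1) 1) : 0 ≤ 1 - x ^ 2 :=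
  sub_nonneg.2 ((sq_le_one_iff_abs_le_one x).2 (abs_le.2 (Set.Ioc_subset_Icc_self hx)))

theorem integral_gegenbauerMeasure {E : Type*} [NormedAddCommGroup E] [NormedSpace ℝ E]
    (ha : 1 / 2 < a) (f : ℝ → E) :
    ∫ x, f x ∂gegenbauerMeasure a =
      gegenbauerConstant a • ∫ x in -1..1, (1 - x ^ 2) ^ (a - 3 / 2) • f x := by
  rw [gegenbauerMeasure, integral_withDensity_eq_integral_toReal_smul (by fun_prop) (by simp),
    intervalIntegral.integral_of_le (by norm_num), ← integral_smul]
  refine setIntegral_congr_fun measurableSet_Ioc fun x hx => ?_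
  rw [ENNReal.toReal_ofReal (mul_nonneg (gegenbauerConstant_pos ha).le
    (Real.rpow_nonneg (one_sub_sq_nonneg hx) _)), mul_smul]

theorem isProbabilityMeasure_gegenbauerMeasure (ha : 1 / 2 < a) :
    IsProbabilityMeasure (gegenbauerMeasure a) := by
  have integrable : IntervalIntegrable (fun x : ℝ => (1 - x ^ 2) ^ (a - 3 / 2)) volume (-1) 1 := by
    convert intervalIntegrable_one_sub_sq_rpow (sub_pos.2 ha) using 3
    ring
  have nonneg : 0 ≤ᵐ[volume.restrict (Set.Ioc (-1) 1)]
      fun x : ℝ => gegenbauerConstant a * (1 - x ^ 2) ^ (a - 3 / 2) := by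
    filter_upwards [ae_restrict_mem measurableSet_Ioc] with x hx
    exact mul_nonneg (gegenbauerConstant_pos ha).le (Real.rpow_nonneg (one_sub_sq_nonneg hx) _)
  refine ⟨?_⟩
  rw [gegenbauerMeasure, withDensity_apply _ .univ, Measure.restrict_univ,
    ← ofReal_integral_eq_lintegral_ofReal (integrable.1.const_mul _) nonneg,
    ← intervalIntegral.integral_of_le (by norm_num), intervalIntegral.integral_const_mul,
    gegenbauerConstant_mul_integral ha, ENNReal.ofReal_one]

theorem isGegenbauerLaw_gegenbauerMeasure (ha : 1 / 2 < a) :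
    IsGegenbauerLaw a (gegenbauerMeasure a) where
  toIsProbabilityMeasure := isProbabilityMeasure_gegenbauerMeasure ha
  ae_mem := (withDensity_absolutelyContinuous _ _).ae_le <|
    (ae_restrict_mem measurableSet_Ioc).mono fun _ hx => Set.Ioc_subset_Icc_self hx
  integral_id := by
    simp only [integral_gegenbauerMeasure ha, smul_eq_mul, mul_comm (_ ^ _),
      integral_id_mul_one_sub_sq_rpow, mul_zero]
  integral_pow_add_two n := by
    have h := integral_pow_add_two_mul_one_sub_sq_rpow (sub_pos.2 ha) n
    rw [show a - 1 / 2 - 1 = a - 3 / 2 by ring] at h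
    simp only [integral_gegenbauerMeasure ha, smul_eq_mul, mul_comm (_ ^ (a - 3 / 2))]
    linear_combination gegenbauerConstant a * h

end GegenbauerMeasure

section ZonalFunction

theorem norm_sq_hyperbolicRotation_symm_fst (p q : ℕ) [NeZero p] [NeZero q] (α : ℝ)
    {u : EuclideanSpace ℝ (Fin q)} (hu : ‖u‖ = 1) (v : EuclideanSpace ℝ (Fin p)) :
    ‖((hyperbolicRotation p q α).symm (u, v)).1‖ ^ 2 = zonalKernel α (v 0) (u 0) := by
  change ‖u + EuclideanSpace.single 0 ((Real.cosh α - 1) * u 0 - Real.sinh α * v 0)‖ ^ 2 = _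
  rw [norm_add_sq_real, EuclideanSpace.inner_single_right, PiLp.norm_single, hu,
    Real.norm_eq_abs, sq_abs, zonalKernel, conj_trivial]
  linear_combination (u 0) ^ 2 * Real.cosh_sq α

theorem measurable_zonalKernel_cpow (α : ℝ) (s : ℂ) :
    Measurable fun w : ℝ × ℝ => (zonalKernel α w.1 w.2 : ℂ) ^ s := by
  unfold zonalKernel
  fun_prop

theorem zonalKernel_comm (α x y : ℝ) : zonalKernel α x y = zonalKernel α y x := by
  unfold zonalKernel
  ring

theorem IsGegenbauerLaw.integrable_zonalKernel_cpow {a b : ℝ} {ν ν' : Measure ℝ}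
    (h : IsGegenbauerLaw a ν) (h' : IsGegenbauerLaw b ν') (α : ℝ) (s : ℂ) :
    Integrable (fun w => (zonalKernel α w.1 w.2 : ℂ) ^ s) (ν.prod ν') := by
  have continuous_factor (ε : ℝ) :
      Continuous fun w => ((1 - Real.tanh α * kernelRoot ε w : ℝ) : ℂ) ^ s :=
    .cpow (by have := continuous_kernelRoot ε; fun_prop) continuous_const fun w =>
      Complex.ofReal_mem_slitPlane.2 (one_sub_tanh_mul_kernelRoot_pos α ε w)
  have continuous_kernelPow : Continuous fun w => kernelPow s (Real.tanh α) w := by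
    unfold kernelPow
    exact_mod_cast (continuous_factor 1).mul (continuous_factor (-1))
  exact (h.integrable_prod h' (continuous_kernelPow.mul_const _)).congr <|
    (h.ae_mem_prod h').mono fun w hw => (zonalKernel_cpow α hw.1 hw.2 s).symm

theorem norm_tanh_sq_lt_one (α : ℝ) : ‖(Real.tanh α : ℂ) ^ 2‖ < 1 := by
  rw [norm_pow, Complex.norm_real, Real.norm_eq_abs]
  exact pow_lt_one₀ (abs_nonneg _) (Real.abs_tanh_lt_one α) two_ne_zero

theorem summable_norm_hornTerm_zonal (p q : ℕ) [NeZero q] (σ : ℂ) (α : ℝ) :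
    Summable fun n => ‖hornTerm (zonalNum q σ) (zonalDen p q) (tanhSqPoint α) n‖ := by
  have hq : 1 / 2 ≤ ((q : ℂ) / 2).re := by
    simpa using (isGegenbauerLaw_sphereLaw q).half_le
  simp only [hornTerm_zonal]
  exact (finTwoArrowEquiv ℕ).summable_iff.2
    (summable_norm_zonalTerm (p / 2) hq (σ / 2) (norm_tanh_sq_lt_one α))

variable (p q : ℕ) [NeZero p] [NeZero q] (σ : ℂ) (α : ℝ)

theorem integral_prod_sphereLaw {f : ℝ × ℝ → ℂ} (hf : Measurable f) :
    ∫ w, f w ∂(sphereLaw p).prod (sphereLaw q) =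
      ⨍ k, f (k.1.1 0, k.2.1 0) ∂(volume : Measure (EuclideanSpace ℝ (Fin p))).toSphere.prod
        (volume : Measure (EuclideanSpace ℝ (Fin q))).toSphere := by
  have : Nonempty (Fin p) := ⟨0⟩
  have : Nonempty (Fin q) := ⟨0⟩
  have measurable_coordinate (n : ℕ) [NeZero n] :
      Measurable fun θ : Metric.sphere (0 : EuclideanSpace ℝ (Fin n)) 1 => θ.1 0 := by
    fun_prop
  rw [average_eq, sphereLaw, sphereLaw, Measure.prod_smul_left, Measure.prod_smul_right,
    integral_smul_measure, integral_smul_measure,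
    Measure.map_prod_map _ _ (measurable_coordinate p) (measurable_coordinate q),
    integral_map ((measurable_coordinate p).prodMap (measurable_coordinate q)).aemeasurable
      hf.aestronglyMeasurable,
    ← Set.univ_prod_univ, measureReal_prod_prod, mul_inv, mul_smul, ENNReal.toReal_inv,
    ENNReal.toReal_inv]
  rfl

theorem zonalFunction_eq_integral :
    zonalFunction p q σ α =
      ∫ w, (zonalKernel α w.1 w.2 : ℂ) ^ (σ / 2) ∂(sphereLaw p).prod (sphereLaw q) := by
  have := (isGegenbauerLaw_sphereLaw p).toIsProbabilityMeasure
  have := (isGegenbauerLaw_sphereLaw q).toIsProbabilityMeasure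
  have integrand_eq (k : Metric.sphere (0 : EuclideanSpace ℝ (Fin q)) 1 ×
      Metric.sphere (0 : EuclideanSpace ℝ (Fin p)) 1) :
      pseudoAction (hyperbolicRotation p q α) (zonalVector p q σ) (k.1, k.2) *
        starRingEnd ℂ (zonalVector p q σ (k.1, k.2)) =
      (zonalKernel α (k.2.1 0) (k.1.1 0) : ℂ) ^ (σ / 2) := by
    have hu : ‖k.1.1‖ = 1 := norm_eq_of_mem_sphere k.1
    simp only [pseudoAction, zonalVector, hu, Complex.ofReal_one, Complex.one_cpow, map_one,
      mul_one]
    rw [← norm_sq_hyperbolicRotation_symm_fst p q α hu, ofReal_sq_cpow (norm_nonneg _),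
      mul_div_cancel₀ _ two_ne_zero]
  simp only [zonalFunction, sectionInner, integrand_eq]
  exact (integral_prod_sphereLaw q p
    ((measurable_zonalKernel_cpow α _).comp measurable_swap)).symm.trans
    (integral_prod_swap fun w : ℝ × ℝ => (zonalKernel α w.1 w.2 : ℂ) ^ (σ / 2))

variable {p q} in
theorem zonalFunction_eq_integral_integral {ν ν' : Measure ℝ} (h : IsGegenbauerLaw (p / 2) ν)
    (h' : IsGegenbauerLaw (q / 2) ν') :
    zonalFunction p q σ α = ∫ y, ∫ x, (zonalKernel α x y : ℂ) ^ (σ / 2) ∂ν ∂ν' := by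
  have := h.toIsProbabilityMeasure
  have := h'.toIsProbabilityMeasure
  rw [zonalFunction_eq_integral, ← integral_prod_symm _ (h.integrable_zonalKernel_cpow h' α _),
    h.integral_zonalKernel_cpow_eq_tsum h',
    (isGegenbauerLaw_sphereLaw p).integral_zonalKernel_cpow_eq_tsum (isGegenbauerLaw_sphereLaw q)]

theorem zonalFunction_comm : zonalFunction p q σ α = zonalFunction q p σ α := by
  have := (isGegenbauerLaw_sphereLaw p).toIsProbabilityMeasure
  have := (isGegenbauerLaw_sphereLaw q).toIsProbabilityMeasure
  rw [zonalFunction_eq_integral, zonalFunction_eq_integral, ← integral_prod_swap]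
  simp only [Prod.fst_swap, Prod.snd_swap, zonalKernel_comm]

theorem zonalFunction_eq_tsum :
    zonalFunction p q σ α = 1 / (Real.cosh α : ℂ) *
      ∑' k, zonalTerm (p / 2) (q / 2) (σ / 2) ((Real.tanh α : ℂ) ^ 2) k := by
  rw [zonalFunction_eq_integral,
    (isGegenbauerLaw_sphereLaw p).integral_zonalKernel_cpow_eq_tsum (isGegenbauerLaw_sphereLaw q)]
  push_cast
  rfl

theorem zonalFunction_eq_hornSeries :
    zonalFunction p q σ α =
      1 / (Real.cosh α : ℂ) * hornSeries (zonalNum q σ) (zonalDen p q) (tanhSqPoint α) := by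
  simp only [zonalFunction_eq_tsum, hornSeries, hornTerm_zonal]
  rw [← (finTwoArrowEquiv ℕ).tsum_eq]
  rfl

end ZonalFunction

section Hypergeometric

theorem tsum_zonalTerm_half (a s : ℂ) {t : ℂ} (ht : ‖t‖ < 1) :
    ∑' k, zonalTerm a (1 / 2) s t k =
      ordinaryHypergeometric (-s) (1 / 2 - s) a t * (1 - t) ^ (-(s + 1 / 2)) := by
  have hypergeometric : HasSum (fun n => pochhammerSymbol (-s) n * pochhammerSymbol (1 / 2 - s) n /
      (pochhammerSymbol a n * n.factorial) * t ^ n)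
      (ordinaryHypergeometric (-s) (1 / 2 - s) a t) := by
    refine (summable_norm_hypergeometric (-s) (1 / 2 - s) a ht).of_norm.hasSum_iff.2 ?_
    rw [ordinaryHypergeometric_eq_tsum]
    refine tsum_congr fun n => ?_
    simp only [pochhammerSymbol, smul_eq_mul]
    ring
  rw [← (hasSum_mul_prod hypergeometric (hasSum_pochhammerSymbol (s + 1 / 2) ht)).tsum_eq]
  refine tsum_congr fun k => ?_
  rw [zonalTerm, mul_comm (pochhammerSymbol (1 / 2) _) (pochhammerSymbol a _),
    mul_div_mul_right _ _ (pochhammerSymbol_half_ne_zero _),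
    show 1 - (s + 1 / 2) = 1 / 2 - s by ring]
  ring

theorem zonalFunction_one (p : ℕ) [NeZero p] (σ : ℂ) (α : ℝ) :
    zonalFunction p 1 σ α =
      ordinaryHypergeometric (-σ / 2) ((1 - σ) / 2) ((p : ℂ) / 2) ((Real.tanh α : ℂ) ^ 2) *
        (Real.cosh α : ℂ) ^ σ := by
  have hcosh : (Real.cosh α : ℂ) ≠ 0 := Complex.ofReal_ne_zero.2 (Real.cosh_pos α).ne'
  rw [zonalFunction_eq_tsum, Nat.cast_one, tsum_zonalTerm_half _ _ (norm_tanh_sq_lt_one α),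
    one_sub_tanh_sq_cpow, show 2 * (σ / 2 + 1 / 2) = σ + 1 by ring, Complex.cpow_add _ _ hcosh,
    Complex.cpow_one, neg_div, sub_div]
  field_simp

end Hypergeometric

section IntegralRepresentations

variable {p q : ℕ}

theorem half_lt_natCast_div_two (hp : 3 ≤ p) : (1 / 2 : ℝ) < p / 2 := by
  have : (3 : ℝ) ≤ p := by exact_mod_cast hp
  linarith

theorem isGegenbauerLaw_cosLaw_two : IsGegenbauerLaw ((2 : ℕ) / 2) cosLaw := by
  rw [Nat.cast_ofNat, div_self two_ne_zero]
  exact isGegenbauerLaw_cosLaw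

theorem integral_gegenbauerMeasure_div_two (hp : 3 ≤ p) (f : ℝ → ℂ) :
    ∫ x, f x ∂gegenbauerMeasure (p / 2) =
      ((Real.Gamma (p / 2) / (√Real.pi * Real.Gamma ((p - 1) / 2)) : ℝ) : ℂ) *
        ∫ x in (-1 : ℝ)..1, f x * (((1 - x ^ 2) ^ (((p : ℝ) - 3) / 2) : ℝ) : ℂ) := by
  rw [integral_gegenbauerMeasure (half_lt_natCast_div_two hp), gegenbauerConstant, ← sub_div,
    ← sub_div, Complex.real_smul]
  simp only [Complex.real_smul, mul_comm]

theorem integral_cosLaw_integral_zonalKernel_cpow (ν : Measure ℝ) [SFinite ν] (α : ℝ) (s : ℂ) :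
    ∫ y, ∫ x, (zonalKernel α x y : ℂ) ^ s ∂ν ∂cosLaw =
      (2 * Real.pi : ℂ)⁻¹ *
        ∫ φ in (0 : ℝ)..(2 * Real.pi), ∫ x, (zonalKernel α x (Real.cos φ) : ℂ) ^ s ∂ν := by
  rw [integral_cosLaw ((measurable_zonalKernel_cpow α s).stronglyMeasurable.integral_prod_left'
    |>.aestronglyMeasurable), Complex.real_smul]
  push_cast
  rfl

variable [NeZero p] [NeZero q] (σ : ℂ) (α : ℝ)

theorem zonalFunction_eq_integral_of_three_le (hp : 3 ≤ p) (hq : 3 ≤ q) :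
    zonalFunction p q σ α =
      ((Real.Gamma (p / 2) * Real.Gamma (q / 2) /
        (Real.pi * Real.Gamma ((p - 1) / 2) * Real.Gamma ((q - 1) / 2)) : ℝ) : ℂ) *
      ∫ y in (-1 : ℝ)..1, ∫ x in (-1 : ℝ)..1,
        (zonalKernel α x y : ℂ) ^ (σ / 2) *
          (((1 - x ^ 2) ^ (((p : ℝ) - 3) / 2) * (1 - y ^ 2) ^ (((q : ℝ) - 3) / 2) : ℝ) : ℂ) := by
  rw [zonalFunction_eq_integral_integral σ α
    (isGegenbauerLaw_gegenbauerMeasure (half_lt_natCast_div_two hp))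
    (isGegenbauerLaw_gegenbauerMeasure (half_lt_natCast_div_two hq))]
  simp only [integral_gegenbauerMeasure_div_two hp, integral_gegenbauerMeasure_div_two hq,
    mul_assoc, intervalIntegral.integral_const_mul, ← intervalIntegral.integral_mul_const,
    Complex.ofReal_mul]
  rw [← mul_assoc, ← Complex.ofReal_mul, div_mul_div_comm, mul_mul_mul_comm,
    Real.mul_self_sqrt Real.pi_pos.le, mul_comm (Real.Gamma (q / 2)),
    mul_comm (Real.Gamma ((q - 1) / 2))]

theorem zonalFunction_two_right (hp : 3 ≤ p) :
    zonalFunction p 2 σ α =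
      ((Real.Gamma (p / 2) /
        (2 * Real.pi ^ (3 / 2 : ℝ) * Real.Gamma ((p - 1) / 2)) : ℝ) : ℂ) *
      ∫ φ in (0 : ℝ)..(2 * Real.pi), ∫ x in (-1 : ℝ)..1,
        (zonalKernel α x (Real.cos φ) : ℂ) ^ (σ / 2) *
          (((1 - x ^ 2) ^ (((p : ℝ) - 3) / 2) : ℝ) : ℂ) := by
  have law := isGegenbauerLaw_gegenbauerMeasure (half_lt_natCast_div_two hp)
  have := law.toIsProbabilityMeasure
  have pi_pow : Real.pi ^ (3 / 2 : ℝ) = Real.pi * √Real.pi := by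
    rw [show (3 / 2 : ℝ) = 1 + 1 / 2 by norm_num, Real.rpow_add Real.pi_pos, Real.rpow_one,
      ← Real.sqrt_eq_rpow]
  rw [zonalFunction_eq_integral_integral σ α law isGegenbauerLaw_cosLaw_two,
    integral_cosLaw_integral_zonalKernel_cpow, pi_pow]
  simp only [integral_gegenbauerMeasure_div_two hp, intervalIntegral.integral_const_mul]
  push_cast
  ring

theorem zonalFunction_two_two :
    zonalFunction 2 2 σ α =
      ((1 / (4 * Real.pi ^ 2) : ℝ) : ℂ) *
      ∫ φ in (0 : ℝ)..(2 * Real.pi), ∫ χ in (0 : ℝ)..(2 * Real.pi),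
        (zonalKernel α (Real.cos χ) (Real.cos φ) : ℂ) ^ (σ / 2) := by
  have := isGegenbauerLaw_cosLaw.toIsProbabilityMeasure
  have inner (y : ℝ) : ∫ x, (zonalKernel α x y : ℂ) ^ (σ / 2) ∂cosLaw =
      (2 * Real.pi : ℝ)⁻¹ • ∫ χ in (0 : ℝ)..(2 * Real.pi),
        (zonalKernel α (Real.cos χ) y : ℂ) ^ (σ / 2) :=
    integral_cosLaw ((measurable_zonalKernel_cpow α _).comp
      measurable_prodMk_right).aestronglyMeasurable
  rw [zonalFunction_eq_integral_integral σ α isGegenbauerLaw_cosLaw_two isGegenbauerLaw_cosLaw_two,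
    integral_cosLaw_integral_zonalKernel_cpow]
  simp only [inner, Complex.real_smul, intervalIntegral.integral_const_mul]
  push_cast
  ring

end IntegralRepresentations

theorem theorem1 (p q : ℕ) [NeZero p] [NeZero q] (hp : 2 ≤ p) (hq : 1 ≤ q) (σ : ℂ) (α : ℝ) :
    -- integral representations of the zonal function
    (3 ≤ p → 3 ≤ q →
      zonalFunction p q σ α =
        ((Real.Gamma (p / 2) * Real.Gamma (q / 2) /
          (Real.pi * Real.Gamma ((p - 1) / 2) * Real.Gamma ((q - 1) / 2)) : ℝ) : ℂ) *
        ∫ y in (-1 : ℝ)..1, ∫ x in (-1 : ℝ)..1,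
          (zonalKernel α x y : ℂ) ^ (σ / 2) *
            (((1 - x ^ 2) ^ (((p : ℝ) - 3) / 2) * (1 - y ^ 2) ^ (((q : ℝ) - 3) / 2) : ℝ) : ℂ)) ∧
    (3 ≤ p → q = 2 →
      zonalFunction p q σ α =
        ((Real.Gamma (p / 2) /
          (2 * Real.pi ^ (3 / 2 : ℝ) * Real.Gamma ((p - 1) / 2)) : ℝ) : ℂ) *
        ∫ φ in (0 : ℝ)..(2 * Real.pi), ∫ x in (-1 : ℝ)..1,
          (zonalKernel α x (Real.cos φ) : ℂ) ^ (σ / 2) *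
            (((1 - x ^ 2) ^ (((p : ℝ) - 3) / 2) : ℝ) : ℂ)) ∧
    (p = 2 → q = 2 →
      zonalFunction p q σ α =
        ((1 / (4 * Real.pi ^ 2) : ℝ) : ℂ) *
        ∫ φ in (0 : ℝ)..(2 * Real.pi), ∫ χ in (0 : ℝ)..(2 * Real.pi),
          (zonalKernel α (Real.cos χ) (Real.cos φ) : ℂ) ^ (σ / 2)) ∧
    -- the double series converge (absolutely) and represent the zonal function
    Summable (fun n => ‖hornTerm (zonalNum q σ) (zonalDen p q) (tanhSqPoint α) n‖) ∧
    zonalFunction p q σ α =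
      1 / (Real.cosh α : ℂ) * hornSeries (zonalNum q σ) (zonalDen p q) (tanhSqPoint α) ∧
    Summable (fun n => ‖hornTerm (zonalNum p σ) (zonalDen q p) (tanhSqPoint α) n‖) ∧
    zonalFunction p q σ α =
      1 / (Real.cosh α : ℂ) * hornSeries (zonalNum p σ) (zonalDen q p) (tanhSqPoint α) ∧
    -- symmetry in `p` and `q`
    zonalFunction p q σ α = zonalFunction q p σ α ∧
    -- the case `q = 1`
    (q = 1 →
      zonalFunction p q σ α =
        ordinaryHypergeometric (-σ / 2) ((1 - σ) / 2) ((p : ℂ) / 2) ((Real.tanh α : ℂ) ^ 2) *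
          (Real.cosh α : ℂ) ^ σ) := by
  refine ⟨zonalFunction_eq_integral_of_three_le σ α, fun hp' hq' => ?_, fun hp' hq' => ?_,
    summable_norm_hornTerm_zonal p q σ α, zonalFunction_eq_hornSeries p q σ α,
    summable_norm_hornTerm_zonal q p σ α, ?_, zonalFunction_comm p q σ α, fun hq' => ?_⟩
  · subst hq'
    exact zonalFunction_two_right σ α hp'
  · subst hp' hq'
    exact zonalFunction_two_two σ α
  · rw [zonalFunction_comm, zonalFunction_eq_hornSeries]
  · subst hq'
    exact zonalFunction_one p σ α
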